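/- A topological dynamical system $(X,G)$ is a compact metric space $X$ with a continuous action of a countable discrete group $G$. It is minimal if every orbit is dense, and equicontinuous if for every $\varepsilon>0$ there is $\delta>0$ such that $d(x,y)<\delta$ implies $d(gx,gy)<\varepsilon$ for all $g\in G$; it has a free orbit if some point has trivial stabilizer. A Cantor set is a non-empty, compact, metrizable, totally disconnected space without isolated points. A factor map is a continuous, surjective, equivariant map; a factor map $\tau:X\to Z$ is almost 1-1 if $\{x\in X:\tau^{-1}\{\tau(x)\}=\{x\}\}$ is dense in $X$. $\mathcal M(X,G)$ denotes the space of $G$-invariant Borel probability measures on $X$ with the weak topology. Theorem. Let $G$ be a countably infinite residually finite group. Let $(Z,G)$ be a minimal equicontinuous system having a free orbit and such that $Z$ is a Cantor set, and let $\nu$ be its unique invariant probability measure. Let $(Y,G)$ be a minimal system and $\pi:Y\to Z$ a factor map. Then there exist a minimal system $(X,G)$, an almost 1-1 factor map $\tau:X\to Z$, and a Borel equivariant map $\psi:Y\to X$ such that: 1. $\tau\circ\psi=\pi$. 2. There is a Borel set $\tilde Z\subseteq Z$ with $\nu(\tilde Z)=1$ such that $\psi$ is one-to-one on $\pi^{-1}(\tilde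 Z)$. 3. The formula $\psi^*(\mu)(A)=\mu(\psi^{-1}(A))$, for $\mu\in\mathcal M(Y,G)$ and $A\subseteq X$ Borel, defines an affine bijection $\psi^*:\mathcal M(Y,G)\to\mathcal M(X,G)$. 4. If in addition $Y$ is a Cantor set, then $X$ is a Cantor set and $\psi^*$ is an affine homeomorphism from $\mathcal M(Y,G)$ onto $\mathcal M(X,G)$. -/

import Mathlib

open Set Topology MeasureTheory

universe u v w

/-- A Cantor set: a non-empty compact metrizable totally disconnected space without isolated
points. -/
def IsCantorSet (X : Type*) [TopologicalSpace X] : Prop :=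
  Nonempty X ∧ CompactSpace X ∧ TopologicalSpace.MetrizableSpace X ∧
    TotallyDisconnectedSpace X ∧ PerfectSpace X

/-- The action of `G` on `X` is equicontinuous: the family of maps `x ↦ g • x` is uniformly
equicontinuous. -/
def IsEquicontinuousAction (G X : Type*) [Group G] [MulAction G X] [MetricSpace X] : Prop :=
  UniformEquicontinuous (fun (g : G) (x : X) => g • x)

/-- The action of `G` on `X` has a free orbit: some point has trivial stabilizer. -/
def HasFreeOrbit (G X : Type*) [Group G] [MulAction G X] : Prop :=
  ∃ x : X, MulAction.stabilizer G x = ⊥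

/-- Equivariant maps. -/
def IsEquivariant (G : Type*) {X Y : Type*} [Group G] [MulAction G X] [MulAction G Y]
    (f : X → Y) : Prop :=
  ∀ (g : G) (x : X), f (g • x) = g • f x

/-- Factor maps: equivariant continuous surjections. -/
structure IsFactorMap (G : Type*) {X Y : Type*} [Group G] [MulAction G X] [MulAction G Y]
    [TopologicalSpace X] [TopologicalSpace Y] (f : X → Y) : Prop where
  equivariant : IsEquivariant G f
  continuous : Continuous f
  surjective : Function.Surjective f

/-- Almost one-to-one factor maps: the points that are alone in their fibre are dense. -/
structure IsAlmostOneToOneFactorMap (G : Type*) {X Y : Type*} [Group G] [MulAction G X]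
    [MulAction G Y] [TopologicalSpace X] [TopologicalSpace Y] (f : X → Y) : Prop
    extends IsFactorMap G f where
  dense_singleton_fibres : Dense {x : X | f ⁻¹' {f x} = {x}}

/-- The space `M(X, G)` of `G`-invariant Borel probability measures on `X`, with the weak
topology (inherited from `ProbabilityMeasure X`). -/
abbrev InvProbMeasure (G X : Type*) [Group G] [MulAction G X] [MeasurableSpace X] : Type _ :=
  {μ : ProbabilityMeasure X // SMulInvariantMeasure G X (μ : Measure X)}

/-- The measure underlying an element of `M(X, G)`. -/
abbrev InvProbMeasure.meas {G X : Type*} [Group G] [MulAction G X] [MeasurableSpace X]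
    (μ : InvProbMeasure G X) : Measure X :=
  ((μ : ProbabilityMeasure X) : Measure X)

/-- A map between spaces of invariant probability measures is affine if it preserves convex
combinations. -/
def IsAffineOnMeasures {G X Y : Type*} [Group G] [MulAction G X] [MulAction G Y]
    [MeasurableSpace X] [MeasurableSpace Y]
    (F : InvProbMeasure G Y → InvProbMeasure G X) : Prop :=
  ∀ (a b : NNReal) (μ₁ μ₂ μ : InvProbMeasure G Y), a + b = 1 →
    μ.meas = a • μ₁.meas + b • μ₂.meas →
      (F μ).meas = a • (F μ₁).meas + b • (F μ₂).meas

/-! Choose towers in Z: clopen bases `C i` and finite shapes `D i ⊆ G`, with pairwise disjoint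
translates `g • C i`, `g ∈ D i`, and total measure at most 1/2. A point of `g • C i` in no earlier
tower gets the fixed content `g • y i`; a point outside all towers keeps its content from Y. The
contents along the orbit of `π y` form `array ⊤ y`, and X is the closure of the arrays over the
`core`, the set of points whose orbits stay in the towers. The core is a dense G_δ, and over it the
array depends only on the base point; hence X is minimal and almost 1-1 over Z. The core is also
invariant of measure less than 1, so null by unique ergodicity. Off the core some content is the
untouched point of Y, so ψ = `array ⊤` is injective there. The towers are chosen so that finite
pieces of orbits of Y outside the towers are imitated inside later ones (`exists_window`), which
puts every array in X.

The difficulty is that every invariant measure on X must live on the image of ψ. Over a base point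
off the core, the contents at places outside the towers are limits of contents of towers of growing
index. They are related by the action unless boundaries of those towers ("cuts") keep coming between
the places. For non-amenable G the boundary of `D i` need not be a small part of it. So every cut of
level m emits `L m` marks of bounded displacement, recorded in the contents, such that each place is
the target of at most `L m / (m+1)` of them. This bound survives in the closure, and mass transport
gives the cuts of level m probability at most 1/(m+1) for each invariant measure. Hence almost every
point is regular (`ae_isRegular`) and, off the core, lies in the image
(`IsRegular.exists_array_eq`).

The marks come from flows on G (`exists_spreadingFlow`): with almost invariant sets G is tiled
through a finite quotient, otherwise expansion and Hall's theorem give the flow. The `D i` are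
unions of tiles, and tilings are coarsened from step to step so that no later tile separates the
protected window of an earlier tower. Therefore marks with a common target come from one tower
(`IsStage.eq_of_isLocated`), and the bound of the flow applies. -/

section Rank
-- Random rankings of a finite set
open Finset

/-- The rankings of `Q` for which a common element of `A` and `B` comes first in `A ∪ B`. -/
def HasCommonMin {Q R : Type*} [DecidableEq Q] [LE R] (σ : Q → R) (A B : Finset Q) : Prop :=
  ∃ a ∈ A, a ∈ B ∧ ∀ b ∈ A ∪ B, σ a ≤ σ b

/-- Transpositions exchange the rankings led by two given elements, so every element of `A ∪ B` is
equally likely to come first. The first one lies in the symmetric difference with the corresponding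
probability. -/
theorem card_not_hasCommonMin_mul_le {Q : Type*} [Fintype Q] [DecidableEq Q] (A B : Finset Q)
    [DecidablePred fun σ : Q ≃ Fin (Fintype.card Q) => ¬ HasCommonMin σ A B] :
    #{σ : Q ≃ Fin (Fintype.card Q) | ¬ HasCommonMin σ A B} * #(A ∪ B) ≤
      #((A \ B) ∪ (B \ A)) * Fintype.card (Q ≃ Fin (Fintype.card Q)) := by
  classical
  rcases (A ∪ B).eq_empty_or_nonempty with hU | ⟨b₀, hb₀⟩
  · simp [hU]
  let N : Q → Finset (Q ≃ Fin (Fintype.card Q)) := fun b => {σ | ∀ c ∈ A ∪ B, σ b ≤ σ c}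
  have hswap : ∀ b ∈ A ∪ B, #(N b₀) ≤ #(N b) := by
    intro b hb
    refine Finset.card_le_card_of_injOn (fun σ => (Equiv.swap b b₀).trans σ) ?_ ?_
    · intro σ hσ
      simp only [N, Finset.coe_filter, Finset.mem_univ, true_and, Set.mem_ofPred_eq] at hσ ⊢
      intro c hc
      simp only [Equiv.trans_apply, Equiv.swap_apply_left]
      apply hσ
      rw [Equiv.swap_apply_def]
      split_ifs <;> assumption
    · intro σ _ τ _ h
      ext x
      have := congrArg (fun e : Q ≃ Fin (Fintype.card Q) => e (Equiv.swap b b₀ x)) h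
      simpa using congrArg Fin.val this
  have hswap' : ∀ b ∈ A ∪ B, #(N b) ≤ #(N b₀) := by
    intro b hb
    refine Finset.card_le_card_of_injOn (fun σ => (Equiv.swap b b₀).trans σ) ?_ ?_
    · intro σ hσ
      simp only [N, Finset.coe_filter, Finset.mem_univ, true_and, Set.mem_ofPred_eq] at hσ ⊢
      intro c hc
      simp only [Equiv.trans_apply, Equiv.swap_apply_right]
      apply hσ
      rw [Equiv.swap_apply_def]
      split_ifs <;> assumption
    · intro σ _ τ _ h
      ext x
      have := congrArg (fun e : Q ≃ Fin (Fintype.card Q) => e (Equiv.swap b b₀ x)) h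
      simpa using congrArg Fin.val this
  have hbad : #{σ : Q ≃ Fin (Fintype.card Q) | ¬ HasCommonMin σ A B} ≤ #((A \ B) ∪ (B \ A)) * #(N b₀) := by
    have hsub : ({σ : Q ≃ Fin (Fintype.card Q) | ¬ HasCommonMin σ A B} : Finset _) ⊆
        ((A \ B) ∪ (B \ A)).biUnion N := by
      intro σ hσ
      simp only [Finset.mem_filter, Finset.mem_univ, true_and] at hσ
      obtain ⟨a, ha, hmin⟩ := Finset.exists_min_image (A ∪ B) σ ⟨b₀, hb₀⟩
      refine Finset.mem_biUnion.2 ⟨a, ?_, by simpa [N] using hmin⟩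
      by_contra hcon
      apply hσ
      simp only [Finset.mem_union, Finset.mem_sdiff] at ha hcon
      exact ⟨a, by tauto, by tauto, hmin⟩
    calc _ ≤ _ := Finset.card_le_card hsub
      _ ≤ _ := Finset.card_biUnion_le_card_mul _ _ _ (fun b hb => hswap' b (by
          simp only [Finset.mem_union, Finset.mem_sdiff] at hb ⊢; tauto))
  have htot : #(A ∪ B) * #(N b₀) ≤ Fintype.card (Q ≃ Fin (Fintype.card Q)) := by
    have hdisj : ∀ b ∈ A ∪ B, ∀ c ∈ A ∪ B, b ≠ c → Disjoint (N b) (N c) := by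
      intro b hb c hc hbc
      rw [Finset.disjoint_left]
      intro σ h1 h2
      simp only [N, Finset.mem_filter, Finset.mem_univ, true_and] at h1 h2
      exact hbc (σ.injective (le_antisymm (h1 c hc) (h2 b hb)))
    calc #(A ∪ B) * #(N b₀) = ∑ b ∈ A ∪ B, #(N b₀) := by simp
      _ ≤ ∑ b ∈ A ∪ B, #(N b) := Finset.sum_le_sum hswap
      _ = #((A ∪ B).biUnion N) := (Finset.card_biUnion hdisj).symm
      _ ≤ _ := Finset.card_le_univ _
  calc _ ≤ #((A \ B) ∪ (B \ A)) * #(N b₀) * #(A ∪ B) := Nat.mul_le_mul_right _ hbad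
    _ = #((A \ B) ∪ (B \ A)) * (#(A ∪ B) * #(N b₀)) := by ring
    _ ≤ _ := Nat.mul_le_mul_left _ htot

/-- Averaging over all rankings: each index fails with probability at most `2 / m`, so some ranking
has at most the expected number of failures. -/
theorem exists_rank_few_not_hasCommonMin {Q ι : Type*} [Fintype Q] [DecidableEq Q] (I : Finset ι)
    (A B : ι → Finset Q) (m : ℕ) (hne : ∀ i ∈ I, (A i).Nonempty)
    (h : ∀ i ∈ I, m * #((A i \ B i) ∪ (B i \ A i)) ≤ 2 * #(A i)) :
    ∃ σ : Q ≃ Fin (Fintype.card Q), ∀ J ⊆ I, (∀ i ∈ J, ¬ HasCommonMin σ (A i) (B i)) →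
      m * #J ≤ 2 * #I := by
  classical
  set P := Fintype.card (Q ≃ Fin (Fintype.card Q))
  have hP : 0 < P := Fintype.card_pos_iff.2 ⟨Fintype.equivFin Q⟩
  have h1 : ∀ i ∈ I, m * #{σ : Q ≃ Fin (Fintype.card Q) | ¬ HasCommonMin σ (A i) (B i)} ≤
      2 * P := by
    intro i hi
    have hc := card_not_hasCommonMin_mul_le (A i) (B i)
    have hpos : 0 < #(A i ∪ B i) := Finset.card_pos.2 ((hne i hi).mono Finset.subset_union_left)
    have hle : #(A i) ≤ #(A i ∪ B i) := Finset.card_le_card Finset.subset_union_left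
    refine Nat.le_of_mul_le_mul_right ?_ hpos
    calc _ = m * (#{σ : Q ≃ Fin (Fintype.card Q) | ¬ HasCommonMin σ (A i) (B i)} *
          #(A i ∪ B i)) := by ring
      _ ≤ m * (#((A i \ B i) ∪ (B i \ A i)) * P) := Nat.mul_le_mul_left _ hc
      _ = (m * #((A i \ B i) ∪ (B i \ A i))) * P := by ring
      _ ≤ (2 * #(A i ∪ B i)) * P := Nat.mul_le_mul_right _ ((h i hi).trans (by omega))
      _ = _ := by ring
  have h2 : ∑ σ : Q ≃ Fin (Fintype.card Q), m * #{i ∈ I | ¬ HasCommonMin σ (A i) (B i)} ≤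
      ∑ σ : Q ≃ Fin (Fintype.card Q), 2 * #I := by
    rw [← Finset.mul_sum]
    simp only [Finset.card_filter]
    rw [Finset.sum_comm]
    simp only [← Finset.card_filter]
    rw [Finset.mul_sum]
    calc _ ≤ ∑ i ∈ I, 2 * P := Finset.sum_le_sum h1
      _ = _ := by simp [P]; ring
  obtain ⟨σ, -, hσ⟩ := Finset.exists_le_of_sum_le
    (Finset.univ_nonempty_iff.2 ⟨Fintype.equivFin Q⟩) h2
  refine ⟨σ, fun J hJ hbad => le_trans (Nat.mul_le_mul_left _ (Finset.card_le_card ?_)) hσ⟩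
  intro i hi
  exact Finset.mem_filter.2 ⟨hJ hi, hbad i hi⟩

end Rank

/-! ### Spreading flows on residually finite groups -/

section Flow
open Finset
open scoped Pointwise

/-- A flow on `G` along displacements in `Φ`, in which every point sends out `L` units of mass and
every point receives at most `L / M` units from the points `g` with `c (k * g) ≠ c g` for some
`k ∈ K`. -/
def IsSpreadingFlow {G : Type*} [Group G] (K : Finset G) (M : ℕ) (Φ : Finset G) (c : G → G) (L : ℕ)
    (T : G → ℕ → G) : Prop :=
  0 < L ∧ (∀ g, c g * g⁻¹ ∈ Φ) ∧ (∀ g l, l < L → T g l * g⁻¹ ∈ Φ) ∧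
    ∀ (w : G) (S : Finset (G × ℕ)),
      (∀ p ∈ S, p.2 < L ∧ (∃ k ∈ K, c (k * p.1) ≠ c p.1) ∧ T p.1 p.2 = w) → M * #S ≤ L

/-- `F` is almost invariant under right translation by the elements of `K`. -/
def IsAlmostInvariant {G : Type*} [Group G] [DecidableEq G] (K : Finset G) (M : ℕ)
    (F : Finset G) : Prop :=
  F.Nonempty ∧ ∀ k ∈ K, M * #(F.image (· * k) \ F) ≤ #F

theorem exists_finiteIndexNormalSubgroup_injOn {G : Type*} [Group G] [Group.ResiduallyFinite G]
    (S : Finset G) : ∃ H : Subgroup G, H.Normal ∧ H.FiniteIndex ∧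
      Set.InjOn (QuotientGroup.mk : G → G ⧸ H) S := by
  classical
  have h : ∀ p : G × G, ∃ H : FiniteIndexNormalSubgroup G,
      p.1 ≠ p.2 → (p.1 : G ⧸ H.toSubgroup) ≠ ↑p.2 := by
    intro p
    by_cases hp : p.1 = p.2
    · obtain ⟨H, -⟩ : ∃ H : FiniteIndexNormalSubgroup G, True :=
        ⟨FiniteIndexNormalSubgroup.ofSubgroup ⊤, trivial⟩
      exact ⟨H, fun h => absurd hp h⟩
    · obtain ⟨H, hH⟩ := Group.exists_finiteIndexNormalSubgroup_of_residuallyFinite p.1 p.2 hp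
      exact ⟨H, fun _ => hH⟩
  choose H hH using h
  refine ⟨⨅ p : (S ×ˢ S : Finset (G × G)), (H p).toSubgroup,
    Subgroup.normal_iInf_normal fun p => inferInstance,
    Subgroup.finiteIndex_iInf fun p => inferInstance, ?_⟩
  intro g hg h hh hgh
  by_contra hne
  refine hH (g, h) hne ?_
  rw [QuotientGroup.eq] at hgh ⊢
  exact (Subgroup.mem_iInf.1 hgh) ⟨(g, h), by simpa using ⟨hg, hh⟩⟩

theorem image_sdiff_image_subset_sdiff {α β : Type*} [DecidableEq α] [DecidableEq β] (f : α → β)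
    (s t : Finset α) : s.image f \ t.image f ⊆ (s \ t).image f := by
  intro x hx
  simp only [Finset.mem_sdiff, Finset.mem_image] at hx ⊢
  obtain ⟨⟨a, ha, rfl⟩, h⟩ := hx
  exact ⟨a, ⟨ha, fun hat => h ⟨a, hat, rfl⟩⟩, rfl⟩

/-- The tile of `g` is the element of `F * g` whose class in a finite quotient ranks lowest. The
candidates of `g` and `k * g` almost coincide, so few classes are cut. The mass of a point is spread
over one representative of each class, so a point receives no more units than there are pairs of a
class and an element of `K` that cuts it. -/
theorem exists_spreadingFlow_of_almostInvariant {G : Type*} [Group G] [DecidableEq G]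
    [Group.ResiduallyFinite G] (K : Finset G) (M : ℕ) (F : Finset G)
    (hF : IsAlmostInvariant K (2 * M * #K) F) :
    ∃ Φ c L T, IsSpreadingFlow K M Φ c L T := by
  classical
  -- Injectivity on `F ∪ F * K` lifts equality of the lowest classes in the quotient to equality of
  -- tiles in G.
  obtain ⟨H, hn, hfin, hinj⟩ := exists_finiteIndexNormalSubgroup_injOn (F ∪ F * K)
  have : Fintype (G ⧸ H) := Subgroup.fintypeQuotientOfFiniteIndex
  let f : G →* G ⧸ H := QuotientGroup.mk' H
  have hfinj : Set.InjOn f (F ∪ F * K : Finset G) := hinj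
  have hFS : ∀ h ∈ F, h ∈ (F ∪ F * K : Finset G) := fun h hh => Finset.mem_union_left _ hh
  have hFK : ∀ h ∈ F, ∀ k ∈ K, h * k ∈ (F ∪ F * K : Finset G) := fun h hh k hk =>
    Finset.mem_union_right _ (Finset.mul_mem_mul hh hk)
  let A : (G ⧸ H) → Finset (G ⧸ H) := fun q => F.image fun h => f h * q
  -- In `2 * M * #K` the factor `#K` pays for indexing by pairs and the 2 for the constant of the
  -- averaging bound.
  obtain ⟨σ, hσ⟩ := exists_rank_few_not_hasCommonMin
    (Finset.univ ×ˢ K : Finset ((G ⧸ H) × G)) (fun p => A p.1) (fun p => A (f p.2 * p.1))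
    (2 * M * #K) (fun p _ => hF.1.image _) (by
      rintro ⟨q, k⟩ hp
      have hk : k ∈ K := (Finset.mem_product.1 hp).2
      have hcardA : #(A q) = #F := Finset.card_image_of_injOn (by
        intro a ha b hb hab
        exact hfinj (hFS a ha) (hFS b hb) (mul_right_cancel hab))
      have hBeq : A (f k * q) = (F.image (· * k)).image fun h => f h * q := by
        simp only [A, Finset.image_image]
        congr 1
        ext h
        simp [mul_assoc]
      have h1 : #(A (f k * q) \ A q) ≤ #(F.image (· * k) \ F) := by
        rw [hBeq]
        exact (Finset.card_le_card (image_sdiff_image_subset_sdiff _ _ _)).trans Finset.card_image_le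
      have h2 : #(A q \ A (f k * q)) ≤ #(F.image (· * k) \ F) := by
        rw [hBeq]
        have : #(F \ F.image (· * k)) = #(F.image (· * k) \ F) :=
          Finset.card_sdiff_comm (Finset.card_image_of_injective _ (mul_left_injective k)).symm
        rw [← this]
        exact (Finset.card_le_card (image_sdiff_image_subset_sdiff _ _ _)).trans Finset.card_image_le
      have h3 := hF.2 k hk
      calc 2 * M * #K * #((A q \ A (f k * q)) ∪ (A (f k * q) \ A q))
          ≤ 2 * M * #K * (2 * #(F.image (· * k) \ F)) :=
            Nat.mul_le_mul_left _ ((Finset.card_union_le _ _).trans (by omega))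
        _ = 2 * (2 * M * #K * #(F.image (· * k) \ F)) := by ring
        _ ≤ _ := by rw [hcardA]; omega)
  have hmin : ∀ q : G ⧸ H, ∃ h ∈ F, ∀ h' ∈ F, σ (f h * q) ≤ σ (f h' * q) := fun q =>
    Finset.exists_min_image F (fun h => σ (f h * q)) hF.1
  choose m hmF hmle using hmin
  have hgood : ∀ g, ∀ k ∈ K, HasCommonMin σ (A (f g)) (A (f k * f g)) →
      m (f (k * g)) * (k * g) = m (f g) * g := by
    intro g k hk ⟨a, ha, ha', hle⟩
    obtain ⟨h, hh, rfl⟩ := Finset.mem_image.1 ha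
    obtain ⟨h', hh', heq⟩ := Finset.mem_image.1 ha'
    have e1 : m (f g) = h := by
      refine hfinj (hFS _ (hmF _)) (hFS _ hh) (mul_right_cancel (b := f g) (σ.injective ?_))
      exact le_antisymm (hmle _ _ hh) (hle _ (Finset.mem_union_left _
        (Finset.mem_image_of_mem _ (hmF _))))
    have e2 : m (f (k * g)) = h' := by
      refine hfinj (hFS _ (hmF _)) (hFS _ hh')
        (mul_right_cancel (b := f (k * g)) (σ.injective (le_antisymm (hmle _ _ hh') ?_)))
      rw [map_mul f, heq]
      exact hle _ (Finset.mem_union_right _ (Finset.mem_image_of_mem _ (by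
        rw [← map_mul f]; exact hmF _)))
    have e3 : h' * k = h := by
      refine hfinj (hFK _ hh' _ hk) (hFS _ hh) (mul_right_cancel (b := f g) ?_)
      rw [map_mul, mul_assoc]; exact heq
    rw [e1, e2, ← e3, mul_assoc]
  obtain ⟨L, hL⟩ : ∃ L, L = Fintype.card (G ⧸ H) := ⟨_, rfl⟩
  obtain ⟨e⟩ : Nonempty (Fin L ≃ G ⧸ H) := ⟨hL ▸ (Fintype.equivFin _).symm⟩
  let s : ℕ → G := fun l => if hl : l < L then (e ⟨l, hl⟩).out else 1
  have hs : ∀ l (hl : l < L), f (s l) = e ⟨l, hl⟩ := by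
    intro l hl
    simp only [s, hl, dif_pos]
    exact Quotient.out_eq _
  refine ⟨F ∪ (Finset.range L).image s, fun g => m (f g) * g, L, fun g l => s l * g,
    hL ▸ Fintype.card_pos_iff.2 ⟨1⟩, fun g => ?_, fun g l hl => ?_, fun w S hS => ?_⟩
  · simpa using Or.inl (hmF _)
  · rw [mul_inv_cancel_right]
    exact Finset.mem_union_right _ (Finset.mem_image_of_mem _ (Finset.mem_range.2 hl))
  · rcases S.eq_empty_or_nonempty with rfl | ⟨p₀, hp₀⟩
    · simp
    have hkex : ∀ p ∈ S, ∃ k ∈ K, ¬ HasCommonMin σ (A (f p.1)) (A (f k * f p.1)) := by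
      intro p hp
      obtain ⟨-, ⟨k, hk, hne⟩, -⟩ := hS p hp
      exact ⟨k, hk, fun h => hne (hgood _ _ hk h)⟩
    have hK : 0 < #K := Finset.card_pos.2 (by
      obtain ⟨k, hk, -⟩ := hkex p₀ hp₀; exact ⟨k, hk⟩)
    choose! κ hκ hκ' using hkex
    have hJ := hσ (S.image fun p => (f p.1, κ p)) (by
      intro x hx
      obtain ⟨p, hp, rfl⟩ := Finset.mem_image.1 hx
      simpa using hκ p hp) (by
      intro x hx
      obtain ⟨p, hp, rfl⟩ := Finset.mem_image.1 hx
      exact hκ' p hp)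
    rw [Finset.card_image_of_injOn, Finset.card_product, Finset.card_univ] at hJ
    · have : (2 * #K) * (M * #S) ≤ (2 * #K) * L := by
        calc _ = 2 * M * #K * #S := by ring
          _ ≤ _ := hJ
          _ = _ := by rw [hL]; ring
      exact Nat.le_of_mul_le_mul_left this (by omega)
    -- The class of the source and the target `w` determine the class of the representative, hence
    -- the slot; the slot and `w` determine the source.
    · intro p hp p' hp' hpp
      simp only [Prod.mk.injEq] at hpp
      obtain ⟨hl, -, hw⟩ := hS p hp
      obtain ⟨hl', -, hw'⟩ := hS p' hp'
      have h1 : f (s p.2) * f p.1 = f (s p'.2) * f p'.1 := by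
        rw [← map_mul, ← map_mul]; exact congrArg f (hw.trans hw'.symm)
      rw [hpp.1] at h1
      have h2 := mul_right_cancel h1
      rw [hs _ hl, hs _ hl'] at h2
      have h3 : p.2 = p'.2 := by simpa using e.injective h2
      refine Prod.ext ?_ h3
      rw [h3] at hw
      exact mul_left_cancel (hw.trans hw'.symm)

/-- Without almost invariant sets, multiplication by `insert 1 K₀⁻¹` enlarges every finite set by
the factor `(m + 1) / m`. A power enlarges by `L = M + 1`, and Hall's theorem gives an injection `G
× Fin L → G` of bounded displacement. Tiles are single points, and a point receives at most one
unit. -/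
theorem exists_spreadingFlow_of_expanding {G : Type*} [Group G] [DecidableEq G] (K : Finset G)
    (M : ℕ) (K₀ : Finset G) (m : ℕ) (h : ∀ F : Finset G, ¬ IsAlmostInvariant K₀ m F) :
    ∃ Φ c L T, IsSpreadingFlow K M Φ c L T := by
  have hstep : ∀ F : Finset G, (m + 1) * #F ≤ m * #(insert 1 K₀⁻¹ * F) := by
    intro F
    rcases F.eq_empty_or_nonempty with rfl | hF
    · simp
    -- Almost invariance concerns right translates, displacements act on the left; inversion
    -- exchanges the two.
    have h1 := h F⁻¹
    unfold IsAlmostInvariant at h1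
    push Not at h1
    obtain ⟨k, hk, hlt⟩ := h1 hF.inv
    have h2 : F ∪ (F⁻¹.image (· * k) \ F⁻¹)⁻¹ ⊆ insert 1 K₀⁻¹ * F := by
      intro x hx
      rcases Finset.mem_union.1 hx with hx | hx
      · exact Finset.mem_mul.2 ⟨1, by simp, x, hx, by simp⟩
      · rw [Finset.mem_inv', Finset.mem_sdiff, Finset.mem_image] at hx
        obtain ⟨⟨y, hy, hyx⟩, -⟩ := hx
        refine Finset.mem_mul.2 ⟨k⁻¹, by simp [hk], y⁻¹, by simpa using hy, ?_⟩
        rw [← mul_inv_rev, hyx, inv_inv]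
    have h3 : Disjoint F (F⁻¹.image (· * k) \ F⁻¹)⁻¹ := by
      rw [Finset.disjoint_left]
      intro x hx hx'
      rw [Finset.mem_inv', Finset.mem_sdiff] at hx'
      exact hx'.2 (by simpa using hx)
    have h4 := Finset.card_le_card h2
    rw [Finset.card_union_of_disjoint h3, Finset.card_inv] at h4
    rw [Finset.card_inv] at hlt
    nlinarith
  have hpow : ∀ (n : ℕ) (F : Finset G),
      (m + 1) ^ n * #F ≤ m ^ n * #((insert 1 K₀⁻¹) ^ n * F) := by
    intro n
    induction n with
    | zero => intro F; simp
    | succ n ih =>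
      intro F
      have e : (insert 1 K₀⁻¹ : Finset G) ^ (n + 1) * F =
          insert 1 K₀⁻¹ * ((insert 1 K₀⁻¹) ^ n * F) := by
        rw [pow_succ', mul_assoc]
      rw [e]
      calc (m + 1) ^ (n + 1) * #F = (m + 1) * ((m + 1) ^ n * #F) := by ring
        _ ≤ (m + 1) * (m ^ n * #((insert 1 K₀⁻¹) ^ n * F)) := Nat.mul_le_mul_left _ (ih F)
        _ = m ^ n * ((m + 1) * #((insert 1 K₀⁻¹) ^ n * F)) := by ring
        _ ≤ m ^ n * (m * #(insert 1 K₀⁻¹ * ((insert 1 K₀⁻¹) ^ n * F))) :=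
          Nat.mul_le_mul_left _ (hstep _)
        _ = _ := by ring
  set L := M + 1
  have hm : 0 < m := by
    rcases Nat.eq_zero_or_pos m with rfl | hm
    · have := hstep {1}; simp at this
    · exact hm
  obtain ⟨n, hn⟩ : ∃ n : ℕ, L * m ^ n ≤ (m + 1) ^ n := by
    have h1 : (1 : ℝ) < (m + 1) / m := by
      rw [lt_div_iff₀ (by positivity)]; linarith
    obtain ⟨n, hn⟩ := pow_unbounded_of_one_lt (L : ℝ) h1
    refine ⟨n, ?_⟩
    rw [div_pow, lt_div_iff₀ (by positivity)] at hn
    exact_mod_cast hn.le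
  set K₁ : Finset G := (insert 1 K₀⁻¹) ^ n
  have hexp : ∀ F : Finset G, L * #F ≤ #(K₁ * F) := by
    intro F
    have h1 := hpow n F
    have h2 : m ^ n * (L * #F) ≤ m ^ n * #(K₁ * F) := by
      calc _ = L * m ^ n * #F := by ring
        _ ≤ (m + 1) ^ n * #F := Nat.mul_le_mul_right _ hn
        _ ≤ _ := h1
    exact Nat.le_of_mul_le_mul_left h2 (by positivity)
  obtain ⟨φ, hφ, hφK⟩ := (Finset.all_card_le_biUnion_card_iff_exists_injective
    (fun p : G × Fin L => K₁.image (· * p.1))).1 (by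
      intro s
      calc #s ≤ #(s.image Prod.fst ×ˢ (Finset.univ : Finset (Fin L))) :=
            Finset.card_le_card (fun p hp => by
              simp only [Finset.mem_product, Finset.mem_univ, and_true]
              exact Finset.mem_image_of_mem _ hp)
        _ = L * #(s.image Prod.fst) := by simp [mul_comm]
        _ ≤ #(K₁ * s.image Prod.fst) := hexp _
        _ ≤ _ := Finset.card_le_card (by
          intro x hx
          obtain ⟨k, hk, y, hy, rfl⟩ := Finset.mem_mul.1 hx
          obtain ⟨p, hp, rfl⟩ := Finset.mem_image.1 hy
          exact Finset.mem_biUnion.2 ⟨p, hp, Finset.mem_image_of_mem _ hk⟩))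
  refine ⟨insert 1 K₁, id, L, fun g l => if hl : l < L then φ (g, ⟨l, hl⟩) else g,
    Nat.succ_pos _, fun g => by simp, fun g l hl => ?_, fun w S hS => ?_⟩
  · simp only [hl, dif_pos]
    obtain ⟨k, hk, hkg⟩ := Finset.mem_image.1 (hφK (g, ⟨l, hl⟩))
    rw [← hkg]
    simpa using Or.inr hk
  · have : #S ≤ 1 := by
      rw [Finset.card_le_one]
      intro p hp p' hp'
      obtain ⟨hl, -, hw⟩ := hS p hp
      obtain ⟨hl', -, hw'⟩ := hS p' hp'
      simp only [hl, hl', dif_pos] at hw hw'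
      have h1 := hφ (hw.trans hw'.symm)
      simp only [Prod.mk.injEq, Fin.mk.injEq] at h1
      exact Prod.ext h1.1 h1.2
    calc M * #S ≤ M * 1 := Nat.mul_le_mul_left _ this
      _ ≤ L := by omega

/-- The dichotomy concerns only the given `K` and `M`; amenability of G is never decided. -/
theorem exists_spreadingFlow {G : Type*} [Group G] [Group.ResiduallyFinite G]
    (K : Finset G) (M : ℕ) : ∃ Φ c L T, IsSpreadingFlow K M Φ c L T := by
  classical
  by_cases h : ∃ F, IsAlmostInvariant K (2 * M * #K) F
  · obtain ⟨F, hF⟩ := h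
    exact exists_spreadingFlow_of_almostInvariant K M F hF
  · push Not at h
    exact exists_spreadingFlow_of_expanding K M K (2 * M * #K) h

end Flow

/-- Course-of-values recursion. A value is required only for histories satisfying `P`, so the
default `a₀` is never used in the constructed sequence. -/
theorem exists_seq_of_forall_initial {α : Type*} (P : (i : ℕ) → ((k : ℕ) → k < i → α) → α → Prop)
    (h : ∀ (i : ℕ) (u : (k : ℕ) → k < i → α),
      (∀ k hk, P k (fun j hj => u j (hj.trans hk)) (u k hk)) → ∃ a, P i u a) :
    ∃ u : ℕ → α, ∀ i, P i (fun k _ => u k) (u i) := by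
  classical
  obtain ⟨a₀, -⟩ := h 0 (fun k hk => absurd hk (Nat.not_lt_zero k))
    (fun k hk => absurd hk (Nat.not_lt_zero k))
  let step : (i : ℕ) → ((k : ℕ) → k < i → α) → α := fun i u =>
    if hu : ∃ a, P i u a then hu.choose else a₀
  let u : ℕ → α := fun n => Nat.strongRec step n
  have hu : ∀ i, u i = step i (fun k _ => u k) := fun i => by
    simp only [u]
    rw [Nat.strongRec]
  refine ⟨u, fun i => ?_⟩
  induction i using Nat.strong_induction_on with
  | _ i ih =>
    have hex := h i (fun k _ => u k) (fun k hk => ih k hk)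
    rw [hu i]
    simp only [step, hex, dif_pos]
    exact hex.choose_spec

/-! ### Locations, cuts and marks -/

section Bubbles

variable {G Z Y : Type*} [Group G] [MulAction G Z]

/-- `z` lies in the translate by `g ∈ D i` of the base `C i` of the `i`-th tower, and in no tower
of smaller index. -/
def IsLocated (D : ℕ → Finset G) (C : ℕ → Set Z) (z : Z) (i : ℕ) (g : G) : Prop :=
  g ∈ D i ∧ g⁻¹ • z ∈ C i ∧ ∀ k < i, ∀ d ∈ D k, d⁻¹ • z ∉ C k

/-- `g` is an element of `D` which some element of `F` moves out of `D`. -/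
def IsCut (F D : Finset G) (g : G) : Prop :=
  g ∈ D ∧ ∃ f ∈ F, f * g ∉ D

/-- The mark of level `m` that `z` carries is the displacement `k` in the slot `l`. -/
def IsMarked (F : ℕ → Finset G) (D : ℕ → Finset G) (C : ℕ → Set Z) (δ : ℕ → ℕ → G → ℕ → G)
    (m : ℕ) (z : Z) (l : ℕ) (k : G) : Prop :=
  ∃ i g, m ≤ i ∧ IsLocated D C z i g ∧ IsCut (F m) (D i) g ∧ δ m i g l = k

end Bubbles

/-! ### One step of the construction -/

section Stages
open Finset
open scoped Pointwise

variable {G Z Y : Type*} [Group G] [DecidableEq G]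

/-- The data chosen in one step of the construction. -/
structure Stage (G Z Y : Type*) where
  -- `r` is the collapse map inherited from the previous step, with displacements in `A`; `Φ, c, L,
  -- T` is a spreading flow; `D`, `C`, `y` are shape, base and content of the tower; `Ω` is a
  -- symmetric set containing the relevant displacements.
  A : Finset G
  r : Z → G → G
  Φ : Finset G
  c : G → G
  L : ℕ
  T : G → ℕ → G
  y : Y
  D : Finset G
  Ω : Finset G
  C : Set Z

namespace Stage

/-- The displacements of `Stage.t`. -/
def B (s : Stage G Z Y) : Finset G := s.Φ * s.A

/-- The tile map of a stage. -/
def t (s : Stage G Z Y) (z : Z) (g : G) : G := s.c (s.r z g)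

/-- The window protected by a stage. -/
def H (s : Stage G Z Y) : Finset G := s.Ω * s.Ω * s.Ω * s.D

theorem t_mem {s : Stage G Z Y} {K : Finset G} {M : ℕ}
    (hflow : IsSpreadingFlow K M s.Φ s.c s.L s.T) (hr : ∀ z g, s.r z g * g⁻¹ ∈ s.A) (z : Z)
    (g : G) : s.t z g * g⁻¹ ∈ s.B := by
  have : s.t z g * g⁻¹ = (s.c (s.r z g) * (s.r z g)⁻¹) * (s.r z g * g⁻¹) := by
    simp [t, mul_assoc]
  rw [this]
  exact Finset.mul_mem_mul (hflow.2.1 _) (hr z g)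

variable [MulAction G Z]

open Classical in
/-- The map that collapses the protected windows of a stage. -/
noncomputable def nextR (s : Stage G Z Y) (z : Z) (g : G) : G :=
  if hh : ∃ h : G, h • z ∈ s.C ∧ ∃ η ∈ s.H, s.t z g = s.t z (η * h) then hh.choose else s.t z g

/-- The displacements of `Stage.nextR`. -/
def nextA (s : Stage G Z Y) : Finset G := s.H⁻¹ * s.B⁻¹ * s.B ∪ s.B

end Stage

variable [MulAction G Z]

/-- The requirements on the data chosen in the `i`-th step, given the previous choices `u`. -/
structure IsStage [MetricSpace Z] [MeasurableSpace Z] (F : ℕ → Finset G)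
    (tgt : ℕ → Set Y × Finset G) (π : Y → Z) (ν : Measure Z) (i : ℕ)
    (u : (k : ℕ) → k < i → Stage G Z Y) (s : Stage G Z Y) : Prop where
  A_zero : i = 0 → s.A = {1}
  r_zero : i = 0 → s.r = fun _ g => g
  A_succ : ∀ k hk, i = k + 1 → s.A = (u k hk).nextA
  r_succ : ∀ k hk, i = k + 1 → s.r = (u k hk).nextR
  r_mem : ∀ z g, s.r z g * g⁻¹ ∈ s.A
  -- `A * F i * A⁻¹` contains the steps of `F i` seen after the collapse `r`, and the factor `#s.A`
  -- makes up for `r` being up to `#s.A`-to-one.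
  flow : IsSpreadingFlow (s.A * F i * s.A⁻¹) ((i + 1) * #s.A) s.Φ s.c s.L s.T
  free : MulAction.stabilizer G (π s.y) = ⊥
  target : (∃ y ∈ (tgt i).1, ∀ f ∈ (tgt i).2, ∀ k hk, ∀ d ∈ (u k hk).D,
      d⁻¹ • f • π y ∉ (u k hk).C) →
    s.y ∈ (tgt i).1 ∧ ∀ f ∈ (tgt i).2, ∀ k hk, ∀ d ∈ (u k hk).D, d⁻¹ • f • π s.y ∉ (u k hk).C
  -- A union of tiles; those meeting the square are taken so that no element of `F i` is cut.
  mem_D : ∀ g, g ∈ s.D ↔ ∃ w ∈ F i * F i, s.t (π s.y) g = s.t (π s.y) w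
  Ω_succ : ∀ k hk, i = k + 1 → (u k hk).Ω ⊆ s.Ω
  F_subset : F i ⊆ s.Ω
  B_subset : s.B ⊆ s.Ω
  one_mem : 1 ∈ s.Ω
  inv_mem : ∀ g ∈ s.Ω, g⁻¹ ∈ s.Ω
  isClopen : IsClopen s.C
  mem_C : π s.y ∈ s.C
  -- Returns to `C` are so sparse that no tile meets two protected windows.
  disjoint : ∀ g ∈ s.H⁻¹ * s.Ω * s.Ω * s.H, g ≠ 1 → ∀ ζ ∈ s.C, g • ζ ∉ s.C
  -- Earlier towers look alike from every point of `C`, so cuts can be analysed at `π s.y`, where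
  -- the tiles are computed.
  constant : ∀ k hk, ∀ g ∈ (u k hk).D⁻¹ * s.Ω * s.Ω * s.D, ∀ ζ ∈ s.C,
    g • ζ ∈ (u k hk).C ↔ g • π s.y ∈ (u k hk).C
  dist_lt : ∀ g ∈ s.D, ∀ ζ ∈ s.C, dist (g • ζ) (g • π s.y) < 1 / (i + 1)
  measure_le : #s.D * ν s.C ≤ (2⁻¹ : ENNReal) ^ (i + 2)

theorem Stage.nextR_mem {s : Stage G Z Y} (ht : ∀ z g, s.t z g * g⁻¹ ∈ s.B) (z : Z) (g : G) :
    s.nextR z g * g⁻¹ ∈ s.nextA := by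
  unfold Stage.nextR Stage.nextA
  split_ifs with hh
  · obtain ⟨-, η, hη, h⟩ := hh.choose_spec
    set h₀ := hh.choose
    have : h₀ * g⁻¹ = η⁻¹ * (s.t z (η * h₀) * (η * h₀)⁻¹)⁻¹ * (s.t z g * g⁻¹) := by
      rw [h]; group
    rw [this]
    exact Finset.mem_union_left _ (Finset.mul_mem_mul (Finset.mul_mem_mul (Finset.inv_mem_inv hη)
      (Finset.inv_mem_inv (ht _ _))) (ht _ _))
  · exact Finset.mem_union_right _ (ht z g)

theorem exists_isClopen_of_forall_nhds {Z ι : Type*} [TopologicalSpace Z] [CompactSpace Z]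
    [T2Space Z] [TotallyDisconnectedSpace Z] (z : Z) (s : Finset ι) (P : ι → Set Z → Prop)
    (hmono : ∀ i ∈ s, ∀ U V, V ⊆ U → P i U → P i V) (h : ∀ i ∈ s, ∃ U ∈ 𝓝 z, P i U) :
    ∃ C, IsClopen C ∧ z ∈ C ∧ ∀ i ∈ s, P i C := by
  choose! U hU hP using h
  have hN : (⋂ i ∈ s, U i) ∈ 𝓝 z := (Filter.biInter_finset_mem s).2 hU
  obtain ⟨O, hO, hOo, hzO⟩ := mem_nhds_iff.1 hN
  obtain ⟨C, hC, hzC, hCO⟩ := compact_exists_isClopen_in_isOpen hOo hzO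
  refine ⟨C, hC, hzC, fun i hi => hmono i hi _ _ ?_ (hP i hi)⟩
  exact (hCO.trans hO).trans (Set.biInter_subset_of_mem hi)

/-- Every requirement holds near `z`: freeness moves `z` off itself, itineraries through clopen sets
are locally constant, and `z` is not an atom. -/
theorem exists_small_clopen {G Z : Type*} [Group G] [MulAction G Z] [MetricSpace Z]
    [CompactSpace Z] [TotallyDisconnectedSpace Z] [MeasurableSpace Z] [BorelSpace Z]
    [ContinuousConstSMul G Z] (ν : Measure Z) [IsFiniteMeasure ν] (z : Z)
    (hz : MulAction.stabilizer G z = ⊥) (hν : ν {z} = 0) (S D : Finset G)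
    (J : Finset (ℕ × G)) (E : ℕ → Set Z) (hE : ∀ p ∈ J, IsClopen (E p.1)) (ε : ℝ) (hε : 0 < ε)
    (η : ENNReal) (hη : η ≠ 0) :
    ∃ C, IsClopen C ∧ z ∈ C ∧ (∀ g ∈ S, g ≠ 1 → ∀ ζ ∈ C, g • ζ ∉ C) ∧
      (∀ p ∈ J, ∀ ζ ∈ C, p.2 • ζ ∈ E p.1 ↔ p.2 • z ∈ E p.1) ∧
      (∀ g ∈ D, ∀ ζ ∈ C, dist (g • ζ) (g • z) < ε) ∧ #D * ν C ≤ η := by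
  obtain ⟨C₁, hC₁, hz₁, h₁⟩ := exists_isClopen_of_forall_nhds z S
    (fun g C => g ≠ 1 → ∀ ζ ∈ C, g • ζ ∉ C)
    (fun g _ U V hVU h hg ζ hζ hgζ => h hg ζ (hVU hζ) (hVU hgζ)) (by
      intro g _
      by_cases hg : g = 1
      · exact ⟨Set.univ, Filter.univ_mem, fun h => absurd hg h⟩
      have hne : g • z ≠ z := fun h => hg (by
        have : g ∈ MulAction.stabilizer G z := h
        rwa [hz, Subgroup.mem_bot] at this)
      obtain ⟨U, V, hU, hV, hgU, hzV, hd⟩ := t2_separation hne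
      refine ⟨V ∩ (fun ζ => g • ζ) ⁻¹' U, Filter.inter_mem (hV.mem_nhds hzV)
        ((hU.preimage (continuous_const_smul g)).mem_nhds hgU), fun _ ζ hζ hζ' => ?_⟩
      exact Set.disjoint_left.1 hd hζ.2 hζ'.1)
  obtain ⟨C₂, hC₂, hz₂, h₂⟩ := exists_isClopen_of_forall_nhds z J
    (fun p C => ∀ ζ ∈ C, p.2 • ζ ∈ E p.1 ↔ p.2 • z ∈ E p.1)
    (fun g _ U V hVU h ζ hζ => h ζ (hVU hζ)) (by
      intro p hp
      have hc : IsClopen ((fun ζ : Z => p.2 • ζ) ⁻¹' E p.1) :=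
        (hE p hp).preimage (continuous_const_smul p.2)
      by_cases h : p.2 • z ∈ E p.1
      · exact ⟨_, hc.isOpen.mem_nhds h, fun ζ hζ => iff_of_true hζ h⟩
      · exact ⟨_, hc.compl.isOpen.mem_nhds h, fun ζ hζ => iff_of_false hζ h⟩)
  obtain ⟨C₃, hC₃, hz₃, h₃⟩ := exists_isClopen_of_forall_nhds z D
    (fun g C => ∀ ζ ∈ C, dist (g • ζ) (g • z) < ε)
    (fun g _ U V hVU h ζ hζ => h ζ (hVU hζ)) (by
      intro g _
      exact ⟨_, ((continuous_const_smul g).tendsto z) (Metric.ball_mem_nhds _ hε),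
        fun ζ hζ => hζ⟩)
  obtain ⟨O, hzO, hO, hOν⟩ := Set.exists_isOpen_lt_of_lt {z} (μ := ν) (η / (#D + 1)) (by
    rw [hν]; exact ENNReal.div_pos hη (by finiteness))
  obtain ⟨C₄, hC₄, hz₄, h₄⟩ := compact_exists_isClopen_in_isOpen hO (hzO rfl)
  refine ⟨C₁ ∩ C₂ ∩ C₃ ∩ C₄, ((hC₁.inter hC₂).inter hC₃).inter hC₄,
    ⟨⟨⟨hz₁, hz₂⟩, hz₃⟩, hz₄⟩, fun g hg h1 ζ hζ hζ' => h₁ g hg h1 ζ hζ.1.1.1 hζ'.1.1.1,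
    fun p hp ζ hζ => h₂ p hp ζ hζ.1.1.2, fun g hg ζ hζ => h₃ g hg ζ hζ.1.2, ?_⟩
  calc #D * ν (C₁ ∩ C₂ ∩ C₃ ∩ C₄) ≤ (#D + 1) * (η / (#D + 1)) := by
        gcongr
        · exact le_self_add
        · exact (measure_mono (Set.inter_subset_right.trans h₄)).trans hOν.le
    _ ≤ η := ENNReal.mul_div_le

/-- The target condition on `y` is open, earlier bases being clopen, so it can be met over a point
with trivial stabilizer. -/
theorem exists_isStage [Group.ResiduallyFinite G] [MetricSpace Z] [CompactSpace Z]
    [TotallyDisconnectedSpace Z] [MeasurableSpace Z] [BorelSpace Z] [ContinuousConstSMul G Z]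
    [TopologicalSpace Y] (F : ℕ → Finset G) (tgt : ℕ → Set Y × Finset G)
    (htgt : ∀ i, IsOpen (tgt i).1) {π : Y → Z} (hπ : Continuous π) (ν : Measure Z)
    [IsFiniteMeasure ν] (hfree : Dense {y : Y | MulAction.stabilizer G (π y) = ⊥})
    (hν : ∀ z, MulAction.stabilizer G z = ⊥ → ν {z} = 0) [Nonempty Y] (i : ℕ)
    (u : (k : ℕ) → k < i → Stage G Z Y)
    (hu : ∀ k hk, IsStage F tgt π ν k (fun j hj => u j (hj.trans hk)) (u k hk)) :
    ∃ s, IsStage F tgt π ν i u s := by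
  classical
  obtain ⟨A, r, Ω₀, hA0, hr0, hA, hr, hΩ₀⟩ : ∃ (A : Finset G) (r : Z → G → G) (Ω₀ : Finset G),
      (i = 0 → A = {1}) ∧ (i = 0 → r = fun _ g => g) ∧
      (∀ k hk, i = k + 1 → A = (u k hk).nextA) ∧ (∀ k hk, i = k + 1 → r = (u k hk).nextR) ∧
      (∀ k hk, i = k + 1 → (u k hk).Ω ⊆ Ω₀) := by
    cases i with
    | zero => exact ⟨{1}, fun _ g => g, ∅, by simp, by simp, by simp, by simp, by simp⟩
    | succ n =>
      refine ⟨(u n n.lt_succ_self).nextA, (u n n.lt_succ_self).nextR, (u n n.lt_succ_self).Ω,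
        by simp, by simp, ?_, ?_, ?_⟩ <;>
      · rintro k hk h
        obtain rfl : n = k := by omega
        rfl
  obtain ⟨Φ, c, L, T, hflow⟩ := exists_spreadingFlow (A * F i * A⁻¹) ((i + 1) * #A)
  let Good : Set Y := (tgt i).1 ∩ ⋂ f ∈ (tgt i).2, ⋂ k : Fin i, ⋂ d ∈ (u k k.2).D,
    (fun y => d⁻¹ • f • π y) ⁻¹' (u k k.2).Cᶜ
  have hGoodOpen : IsOpen Good := by
    refine (htgt i).inter (isOpen_biInter_finset fun f _ => isOpen_iInter_of_finite fun k =>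
      isOpen_biInter_finset fun d _ => ?_)
    exact ((hu k k.2).isClopen.compl.isOpen).preimage
      ((continuous_const_smul _).comp ((continuous_const_smul _).comp hπ))
  have hGood : ∀ y, y ∈ Good ↔ y ∈ (tgt i).1 ∧
      ∀ f ∈ (tgt i).2, ∀ k hk, ∀ d ∈ (u k hk).D, d⁻¹ • f • π y ∉ (u k hk).C := by
    intro y
    simp only [Good, Set.mem_inter_iff, Set.mem_iInter, Set.mem_preimage, Set.mem_compl_iff]
    exact and_congr_right fun _ => forall₂_congr fun f _ =>
      ⟨fun h k hk => h ⟨k, hk⟩, fun h k => h k k.2⟩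
  obtain ⟨y, hy, htarget⟩ : ∃ y, MulAction.stabilizer G (π y) = ⊥ ∧
      (Good.Nonempty → y ∈ Good) := by
    by_cases hne : Good.Nonempty
    · obtain ⟨y, hyG, hy⟩ := hfree.inter_open_nonempty Good hGoodOpen hne
      exact ⟨y, hy, fun _ => hyG⟩
    · obtain ⟨y, hy⟩ := hfree.nonempty
      exact ⟨y, hy, fun h => absurd h hne⟩
  have hrA : ∀ z g, r z g * g⁻¹ ∈ A := by
    intro z g
    rcases Nat.eq_zero_or_pos i with h0 | h0
    · rw [hA0 h0, hr0 h0]; simp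
    · obtain ⟨k, rfl⟩ : ∃ k, i = k + 1 := ⟨i - 1, by omega⟩
      rw [hA k k.lt_succ_self rfl, hr k k.lt_succ_self rfl]
      exact Stage.nextR_mem (Stage.t_mem (hu k k.lt_succ_self).flow (hu k k.lt_succ_self).r_mem) z g
  let t : Z → G → G := fun z g => c (r z g)
  let B : Finset G := Φ * A
  -- Tiles have bounded displacement; the ambient product only shows that the union of tiles is
  -- finite.
  let D : Finset G := (B⁻¹ * (F i * F i).image (t (π y))).filter
    fun g => ∃ w ∈ F i * F i, t (π y) g = t (π y) w
  have hD : ∀ g, g ∈ D ↔ ∃ w ∈ F i * F i, t (π y) g = t (π y) w := by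
    intro g
    refine ⟨fun h => (Finset.mem_filter.1 h).2, fun h => Finset.mem_filter.2 ⟨?_, h⟩⟩
    obtain ⟨w, hw, hgw⟩ := h
    have hB : t (π y) g * g⁻¹ ∈ B := Stage.t_mem (s := ⟨A, r, Φ, c, L, T, y, ∅, ∅, ∅⟩) hflow hrA _ _
    refine Finset.mem_mul.2 ⟨_, Finset.inv_mem_inv hB, _, Finset.mem_image_of_mem _ hw, ?_⟩
    rw [← hgw]; group
  let Ω₁ : Finset G := {1} ∪ Ω₀ ∪ F i ∪ B
  let Ω : Finset G := Ω₁ ∪ Ω₁⁻¹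
  have hΩ₁ : Ω₁ ⊆ Ω := Finset.subset_union_left
  let H : Finset G := Ω * Ω * Ω * D
  let E : ℕ → Set Z := fun k => if hk : k < i then (u k hk).C else ∅
  let J : Finset (ℕ × G) := (Finset.univ : Finset (Fin i)).biUnion fun k =>
    ((u k k.2).D⁻¹ * Ω * Ω * D).image fun g => ((k : ℕ), g)
  obtain ⟨C, hC, hyC, h1, h2, h3, h4⟩ := exists_small_clopen ν (π y) hy (hν _ hy)
    (H⁻¹ * Ω * Ω * H) D J E (by
      intro p _
      by_cases hk : p.1 < i
      · simp only [E, hk, dif_pos]; exact (hu _ hk).isClopen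
      · simp only [E, hk, dif_neg, not_false_iff]; exact isClopen_empty)
    (1 / (i + 1)) (by positivity) ((2⁻¹ : ENNReal) ^ (i + 2)) (by simp)
  refine ⟨⟨A, r, Φ, c, L, T, y, D, Ω, C⟩, ⟨hA0, hr0, hA, hr, hrA, hflow, hy, ?_, hD, ?_, ?_, ?_, ?_,
    ?_, hC, hyC, h1, ?_, h3, h4⟩⟩
  · rintro ⟨y', hy', hh⟩
    exact (hGood y).1 (htarget ⟨y', (hGood y').2 ⟨hy', hh⟩⟩)
  · intro k hk h
    exact ((hΩ₀ k hk h).trans (by intro x hx; simp [Ω₁, hx])).trans hΩ₁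
  · exact (show F i ⊆ Ω₁ by intro x hx; simp [Ω₁, hx]).trans hΩ₁
  · exact (show B ⊆ Ω₁ by intro x hx; simp [Ω₁, hx]).trans hΩ₁
  · exact hΩ₁ (by simp [Ω₁])
  · intro g hg
    simp only [Ω, Finset.mem_union, Finset.mem_inv', inv_inv] at hg ⊢
    exact hg.symm
  · intro k hk g hg
    have := h2 (k, g) (by
      simp only [J, Finset.mem_biUnion, Finset.mem_image]
      exact ⟨⟨k, hk⟩, Finset.mem_univ _, g, hg, rfl⟩)
    simpa [E, hk] using this

end Stages

/-- The towers along which an extension `π : Y → Z` is modified: the points of `g • C i`, `g ∈ D i`,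
which belong to no tower of smaller index are given the content `g • y i`. -/
structure ReplacementScheme (G : Type*) {Z Y : Type*} [Group G] [MulAction G Z] [MetricSpace Z]
    [MeasurableSpace Z] [TopologicalSpace Y] (π : Y → Z) (ν : Measure Z) where
  F : ℕ → Finset G
  y : ℕ → Y
  D : ℕ → Finset G
  C : ℕ → Set Z
  B : ℕ → Finset G
  L : ℕ → ℕ
  δ : ℕ → ℕ → G → ℕ → G
  F_mono : Monotone F
  exists_mem_F : ∀ g, ∃ m, g ∈ F m
  L_pos : ∀ m, 0 < L m
  δ_mem : ∀ m i g l, l < L m → δ m i g l ∈ B m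
  isClopen : ∀ i, IsClopen (C i)
  disjoint : ∀ i, ∀ g ∈ D i, ∀ g' ∈ D i, ∀ z : Z, g⁻¹ • z ∈ C i → g'⁻¹ • z ∈ C i → g = g'
  dist_lt : ∀ i, ∀ g ∈ D i, ∀ ζ ∈ C i, dist (g • ζ) (g • π (y i)) < 1 / (i + 1)
  measure_le : ∀ i, (D i).card * ν (C i) ≤ (2⁻¹ : ENNReal) ^ (i + 2)
  exists_window : ∀ (y₀ : Y) (V : Set Y), IsOpen V → y₀ ∈ V → ∀ F' : Finset G,
    (∀ f ∈ F', ∀ k, ∀ d ∈ D k, d⁻¹ • f • π y₀ ∉ C k) →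
    ∃ i, y i ∈ V ∧ π (y i) ∈ C i ∧ ∀ ζ ∈ C i, ∀ f ∈ F',
      IsLocated D C (f • ζ) i f ∧ ∀ m ≤ i, ¬ IsCut (F m) (D i) f
  card_le : ∀ (m : ℕ) (z : Z) (S : Finset (G × ℕ)),
    (∀ p ∈ S, p.2 < L m ∧ IsMarked F D C δ m (p.1⁻¹ • z) p.2 p.1) → (m + 1) * S.card ≤ L m

/-! ### Interaction of the steps -/

section Sequence
open Finset
open scoped Pointwise

variable {G Z Y : Type*} [Group G] [DecidableEq G] [MulAction G Z] [MetricSpace Z]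
  [MeasurableSpace Z] {F : ℕ → Finset G} {tgt : ℕ → Set Y × Finset G} {π : Y → Z} {ν : Measure Z}
  {u : ℕ → Stage G Z Y}

namespace IsStage

theorem t_mem (hu : ∀ i, IsStage F tgt π ν i (fun k _ => u k) (u i)) (i : ℕ) (z : Z) (g : G) :
    (u i).t z g * g⁻¹ ∈ (u i).B :=
  Stage.t_mem (hu i).flow (hu i).r_mem z g

theorem Ω_mono (hu : ∀ i, IsStage F tgt π ν i (fun k _ => u k) (u i)) : Monotone fun i => (u i).Ω :=
  monotone_nat_of_le_succ fun n => (hu (n + 1)).Ω_succ n n.lt_succ_self rfl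

/-- `nextR z g` depends on `g` only through `t z g`, so tilings become coarser. -/
theorem t_eq_of_t_eq (hu : ∀ i, IsStage F tgt π ν i (fun k _ => u k) (u i)) {i j : ℕ} (hij : i ≤ j)
    {z : Z} {g g' : G} (h : (u i).t z g = (u i).t z g') : (u j).t z g = (u j).t z g' := by
  induction j, hij using Nat.le_induction with
  | base => exact h
  | succ j _ ih =>
    have hr := (hu (j + 1)).r_succ j j.lt_succ_self rfl
    simp only [Stage.t, hr]
    congr 1
    rw [Stage.nextR, Stage.nextR, ih]

/-- A second candidate in the definition of `nextR` would be a return to `C` excluded by `disjoint`,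
since `B ⊆ Ω`. -/
theorem nextR_eq (hu : ∀ i, IsStage F tgt π ν i (fun k _ => u k) (u i)) {i : ℕ} {z : Z} {h η : G}
    (hh : h • z ∈ (u i).C) (hη : η ∈ (u i).H) : (u i).nextR z (η * h) = h := by
  have hex : ∃ h' : G, h' • z ∈ (u i).C ∧ ∃ η' ∈ (u i).H,
      (u i).t z (η * h) = (u i).t z (η' * h') := ⟨h, hh, η, hη, rfl⟩
  simp only [Stage.nextR, hex, dif_pos]
  obtain ⟨hC, η', hη', heq⟩ := hex.choose_spec
  set h' := hex.choose
  by_contra hne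
  have key : h' * h⁻¹ = η'⁻¹ * ((u i).t z (η' * h') * (η' * h')⁻¹)⁻¹ *
      ((u i).t z (η * h) * (η * h)⁻¹) * η := by
    rw [heq]; group
  have hmem : h' * h⁻¹ ∈ (u i).H⁻¹ * (u i).Ω * (u i).Ω * (u i).H := by
    rw [key]
    exact Finset.mul_mem_mul (Finset.mul_mem_mul (Finset.mul_mem_mul (Finset.inv_mem_inv hη')
      ((hu i).inv_mem _ ((hu i).B_subset (t_mem hu i _ _)))) ((hu i).B_subset (t_mem hu i _ _))) hη
  refine (hu i).disjoint _ hmem (fun h1 => hne (mul_inv_eq_one.1 h1)) _ hh ?_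
  rw [smul_smul, inv_mul_cancel_right]
  exact hC

/-- The window around a return to `C i` is collapsed at step `i + 1`, so it lies in one tile of each
later step, and `D j` is a union of tiles. -/
theorem mem_D_of_mem_D (hu : ∀ i, IsStage F tgt π ν i (fun k _ => u k) (u i)) {i j : ℕ}
    (hij : i < j) {h η η' : G} (hh : h • π (u j).y ∈ (u i).C) (hη : η ∈ (u i).H)
    (hη' : η' ∈ (u i).H) (hD : η * h ∈ (u j).D) : η' * h ∈ (u j).D := by
  have h1 : (u (i + 1)).t (π (u j).y) (η * h) = (u (i + 1)).t (π (u j).y) (η' * h) := by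
    have hr := (hu (i + 1)).r_succ i i.lt_succ_self rfl
    simp only [Stage.t, hr, nextR_eq hu hh hη, nextR_eq hu hh hη']
  have h2 := t_eq_of_t_eq hu (Nat.succ_le_of_lt hij) h1
  obtain ⟨w, hw, hgw⟩ := ((hu j).mem_D _).1 hD
  exact ((hu j).mem_D _).2 ⟨w, hw, h2 ▸ hgw⟩

/-- If the two colours agreed, `g` and `f * g` would share a tile at step `m`, hence at step `j`,
and `D j` could not separate them. -/
theorem exists_c_ne_of_isCut (hu : ∀ i, IsStage F tgt π ν i (fun k _ => u k) (u i)) {m j : ℕ}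
    (hmj : m ≤ j) {g : G} (hg : IsCut (F m) (u j).D g) :
    ∃ k ∈ (u m).A * F m * (u m).A⁻¹,
      (u m).c (k * (u m).r (π (u j).y) g) ≠ (u m).c ((u m).r (π (u j).y) g) := by
  obtain ⟨hgD, f, hf, hfg⟩ := hg
  set z := π (u j).y
  refine ⟨((u m).r z (f * g) * (f * g)⁻¹) * f * ((u m).r z g * g⁻¹)⁻¹,
    Finset.mul_mem_mul (Finset.mul_mem_mul ((hu m).r_mem _ _) hf)
      (Finset.inv_mem_inv ((hu m).r_mem _ _)), fun heq => hfg ?_⟩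
  have e : (u m).r z (f * g) * (f * g)⁻¹ * f * ((u m).r z g * g⁻¹)⁻¹ * (u m).r z g =
      (u m).r z (f * g) := by group
  rw [e] at heq
  obtain ⟨w, hw, hgw⟩ := ((hu j).mem_D _).1 hgD
  exact ((hu j).mem_D _).2 ⟨w, hw, (t_eq_of_t_eq hu hmj heq).trans hgw⟩

/-- The displacements of the marks. -/
def displacement (π : Y → Z) (u : ℕ → Stage G Z Y) (m i : ℕ) (g : G) (l : ℕ) : G :=
  (u m).T ((u m).r (π (u i).y) g) l * g⁻¹

theorem displacement_mem (hu : ∀ i, IsStage F tgt π ν i (fun k _ => u k) (u i)) (m i : ℕ) (g : G)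
    {l : ℕ} (hl : l < (u m).L) : displacement π u m i g l ∈ (u m).B := by
  have : displacement π u m i g l = ((u m).T ((u m).r (π (u i).y) g) l *
      ((u m).r (π (u i).y) g)⁻¹) * ((u m).r (π (u i).y) g * g⁻¹) := by
    simp [displacement, mul_assoc]
  rw [this]
  exact Finset.mul_mem_mul ((hu m).flow.2.2.1 _ _ hl) ((hu m).r_mem _ _)

theorem subset_H (hu : ∀ i, IsStage F tgt π ν i (fun k _ => u k) (u i)) (i : ℕ) :
    (u i).D ⊆ (u i).H := by
  intro g hg
  have h1 := (hu i).one_mem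
  have := Finset.mul_mem_mul (Finset.mul_mem_mul (Finset.mul_mem_mul h1 h1) h1) hg
  simpa [Stage.H] using this

/-- Two marks which are sent to the same point come from the same tower. -/
theorem eq_of_isLocated (hu : ∀ i, IsStage F tgt π ν i (fun k _ => u k) (u i)) {m i j : ℕ}
    (hmi : m ≤ i) (hij : i ≤ j) {z : Z} {k₁ k₂ g₁ g₂ : G} (hk₁ : k₁ ∈ (u m).B)
    (hk₂ : k₂ ∈ (u m).B)
    (h₁ : IsLocated (fun i => (u i).D) (fun i => (u i).C) (k₁⁻¹ • z) i g₁)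
    (h₂ : IsLocated (fun i => (u i).D) (fun i => (u i).C) (k₂⁻¹ • z) j g₂)
    (hc : IsCut (F m) (u j).D g₂) : i = j ∧ k₁ * g₁ = k₂ * g₂ := by
  have hB : ∀ n, m ≤ n → ∀ k ∈ (u m).B, k ∈ (u n).Ω := fun n hn k hk =>
    Ω_mono hu hn ((hu m).B_subset hk)
  have hB' : ∀ n, m ≤ n → ∀ k ∈ (u m).B, k⁻¹ ∈ (u n).Ω := fun n hn k hk =>
    (hu n).inv_mem _ (hB n hn k hk)
  set ζ := g₂⁻¹ • k₂⁻¹ • z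
  set h := g₁⁻¹ * k₁⁻¹ * k₂ * g₂
  have hz : g₁⁻¹ • k₁⁻¹ • z = h • ζ := by
    simp only [h, ζ, smul_smul]; congr 1; group
  have hζ : ζ ∈ (u j).C := h₂.2.1
  have hhζ : h • ζ ∈ (u i).C := hz ▸ h₁.2.1
  rcases hij.eq_or_lt with rfl | hlt
  · refine ⟨rfl, ?_⟩
    by_contra hne
    refine (hu i).disjoint h ?_ (fun h1 => hne ?_) ζ hζ hhζ
    · exact Finset.mul_mem_mul (Finset.mul_mem_mul (Finset.mul_mem_mul
        (Finset.inv_mem_inv (subset_H hu i h₁.1)) (hB' i hmi _ hk₁)) (hB i hmi _ hk₂))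
        (subset_H hu i h₂.1)
    · have : k₁ * g₁ * h = k₂ * g₂ := by simp only [h]; group
      rw [← this, h1, mul_one]
  -- Now `g₂` and `f * g₂` both lie in the window of the `i`-th tower around `h`, which `D j` cannot
  -- separate; so `g₂` is not cut by `f`.
  · exfalso
    have hmem : h ∈ (u i).D⁻¹ * (u j).Ω * (u j).Ω * (u j).D :=
      Finset.mul_mem_mul (Finset.mul_mem_mul (Finset.mul_mem_mul
        (Finset.inv_mem_inv h₁.1) (hB' j (hmi.trans hij) _ hk₁)) (hB j (hmi.trans hij) _ hk₂)) h₂.1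
    have hC : h • π (u j).y ∈ (u i).C := ((hu j).constant i hlt h hmem ζ hζ).1 hhζ
    obtain ⟨hg₂, f, hf, hfg⟩ := hc
    have hfΩ : f ∈ (u i).Ω := Ω_mono hu hmi ((hu m).F_subset hf)
    have e₁ : k₂⁻¹ * k₁ * g₁ * h = g₂ := by simp only [h]; group
    have e₂ : f * k₂⁻¹ * k₁ * g₁ * h = f * g₂ := by rw [← e₁]; group
    have m₂ : f * k₂⁻¹ * k₁ * g₁ ∈ (u i).H :=
      Finset.mul_mem_mul (Finset.mul_mem_mul (Finset.mul_mem_mul hfΩ (hB' i hmi _ hk₂))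
        (hB i hmi _ hk₁)) h₁.1
    have m₁ : k₂⁻¹ * k₁ * g₁ ∈ (u i).H := by
      have := Finset.mul_mem_mul (Finset.mul_mem_mul (Finset.mul_mem_mul (hu i).one_mem
        (hB' i hmi _ hk₂)) (hB i hmi _ hk₁)) h₁.1
      simpa only [one_mul, Stage.H] using this
    refine hfg ?_
    rw [← e₂]
    exact mem_D_of_mem_D hu hlt hC m₁ m₂ (by rw [e₁]; exact hg₂)

/-- All marks sent to `z` come from one tower and have the same target `w` in its coordinates. After
the collapse they are arrivals at `w` of the flow of step `m`; passing to the collapse costs the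
factor `#A`. -/
theorem card_le (hu : ∀ i, IsStage F tgt π ν i (fun k _ => u k) (u i)) (m : ℕ) (z : Z)
    (S : Finset (G × ℕ)) (hS : ∀ p ∈ S, p.2 < (u m).L ∧ IsMarked F (fun i => (u i).D)
      (fun i => (u i).C) (displacement π u) m (p.1⁻¹ • z) p.2 p.1) :
    (m + 1) * #S ≤ (u m).L := by
  rcases S.eq_empty_or_nonempty with rfl | ⟨p₀, hp₀⟩
  · simp
  choose! hl i g hmi hloc hcut hδ using hS
  have hB : ∀ p ∈ S, p.1 ∈ (u m).B := fun p hp =>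
    hδ p hp ▸ displacement_mem hu m _ _ (hl p hp)
  have hsame : ∀ p ∈ S, ∀ q ∈ S, i p = i q ∧ p.1 * g p = q.1 * g q := by
    intro p hp q hq
    rcases le_total (i p) (i q) with h | h
    · exact eq_of_isLocated hu (hmi p hp) h (hB p hp) (hB q hq) (hloc p hp) (hloc q hq) (hcut q hq)
    · have := eq_of_isLocated hu (hmi q hq) h (hB q hq) (hB p hp) (hloc q hq) (hloc p hp)
        (hcut p hp)
      exact ⟨this.1.symm, this.2.symm⟩
  set j := i p₀
  set w := p₀.1 * g p₀
  have hi : ∀ p ∈ S, i p = j := fun p hp => (hsame p hp p₀ hp₀).1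
  have hw : ∀ p ∈ S, p.1 * g p = w := fun p hp => (hsame p hp p₀ hp₀).2
  set ρ : G → G := (u m).r (π (u j).y)
  have hflow := (hu m).flow.2.2.2 w (S.image fun p => (ρ (g p), p.2)) (by
    intro x hx
    obtain ⟨p, hp, rfl⟩ := Finset.mem_image.1 hx
    refine ⟨hl p hp, ?_, ?_⟩
    · have := exists_c_ne_of_isCut hu (hmi p hp) (hcut p hp)
      rwa [hi p hp] at this
    · have := hδ p hp
      rw [displacement, hi p hp, mul_inv_eq_iff_eq_mul, hw p hp] at this
      exact this)
  have hcard : #S ≤ #((u m).A ×ˢ S.image fun p => (ρ (g p), p.2)) := by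
    refine Finset.card_le_card_of_injOn (fun p => (ρ (g p) * (g p)⁻¹, (ρ (g p), p.2))) ?_ ?_
    · intro p hp
      exact Finset.mem_product.2 ⟨(hu m).r_mem _ _, Finset.mem_image_of_mem _ hp⟩
    · intro p hp q hq hpq
      simp only [Prod.mk.injEq] at hpq
      obtain ⟨h1, h2, h3⟩ := hpq
      rw [h2] at h1
      have h4 : g p = g q := inv_injective (mul_left_cancel h1)
      refine Prod.ext ?_ h3
      have := (hw p hp).trans (hw q hq).symm
      rw [h4] at this
      exact mul_right_cancel this
  rw [Finset.card_product] at hcard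
  calc (m + 1) * #S ≤ (m + 1) * (#(u m).A * #(S.image fun p => (ρ (g p), p.2))) :=
        Nat.mul_le_mul_left _ hcard
    _ = (m + 1) * #(u m).A * #(S.image fun p => (ρ (g p), p.2)) := by ring
    _ ≤ _ := hflow

theorem eq_of_mem (hu : ∀ i, IsStage F tgt π ν i (fun k _ => u k) (u i)) (i : ℕ) {g g' : G}
    (hg : g ∈ (u i).D) (hg' : g' ∈ (u i).D) {z : Z} (h : g⁻¹ • z ∈ (u i).C)
    (h' : g'⁻¹ • z ∈ (u i).C) : g = g' := by
  by_contra hne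
  have h1 := (hu i).one_mem
  refine (hu i).disjoint (g'⁻¹ * 1 * 1 * g) (Finset.mul_mem_mul (Finset.mul_mem_mul
    (Finset.mul_mem_mul (Finset.inv_mem_inv (subset_H hu i hg')) h1) h1) (subset_H hu i hg))
    (fun e => hne ?_) _ h ?_
  · simpa [inv_mul_eq_one, eq_comm] using e
  · simpa [smul_smul] using h'

/-- `D i` contains `F i * F i`, so `f ∈ F i` is cut at no level `m ≤ i`; `constant` transfers the
avoidance of earlier towers from `π (u i).y` to `ζ`. -/
theorem isLocated_of_target (hu : ∀ i, IsStage F tgt π ν i (fun k _ => u k) (u i)) (i : ℕ)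
    (hF1 : 1 ∈ F i) (hFm : Monotone F) {f : G} (hf : f ∈ F i)
    (h : ∀ k < i, ∀ d ∈ (u k).D, d⁻¹ • f • π (u i).y ∉ (u k).C) {ζ : Z} (hζ : ζ ∈ (u i).C) :
    IsLocated (fun i => (u i).D) (fun i => (u i).C) (f • ζ) i f ∧
      ∀ m ≤ i, ¬ IsCut (F m) (u i).D f := by
  have hFD : ∀ w ∈ F i * F i, w ∈ (u i).D := fun w hw => ((hu i).mem_D w).2 ⟨w, hw, rfl⟩
  have hfD : f ∈ (u i).D := hFD _ (by simpa using Finset.mul_mem_mul hF1 hf)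
  refine ⟨⟨hfD, by simpa using hζ, fun k hk d hd hC => h k hk d hd ?_⟩, fun m hm hcut => ?_⟩
  · have h1 := (hu i).one_mem
    have := (hu i).constant k hk (d⁻¹ * 1 * 1 * f) (Finset.mul_mem_mul (Finset.mul_mem_mul
      (Finset.mul_mem_mul (Finset.inv_mem_inv hd) h1) h1) hfD) ζ hζ
    simp only [mul_one, mul_smul] at this
    exact this.1 hC
  · obtain ⟨-, f', hf', hff'⟩ := hcut
    exact hff' (hFD _ (Finset.mul_mem_mul (hFm hm hf') hf))

end IsStage

end Sequence

/-! ### Existence of a replacement scheme -/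

section Existence
open Finset

theorem exists_monotone_exhaustion (G : Type*) [Group G] [Countable G] :
    ∃ F : ℕ → Finset G, Monotone F ∧ (∀ m, 1 ∈ F m) ∧ ∀ g, ∃ m, g ∈ F m := by
  classical
  obtain ⟨s, hs⟩ := exists_surjective_nat G
  refine ⟨fun m => insert 1 ((Finset.range m).image s), ?_, by simp, fun g => ?_⟩
  · intro m n hmn
    exact Finset.insert_subset_insert _ (Finset.image_subset_image (Finset.range_mono hmn))
  · obtain ⟨n, rfl⟩ := hs g
    exact ⟨n + 1, Finset.mem_insert_of_mem (Finset.mem_image_of_mem _ (by simp))⟩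

theorem nonempty_replacementScheme {G Z Y : Type*} [Group G] [Countable G]
    [Group.ResiduallyFinite G] [MulAction G Z] [MetricSpace Z] [CompactSpace Z]
    [TotallyDisconnectedSpace Z] [MeasurableSpace Z] [BorelSpace Z] [ContinuousConstSMul G Z]
    [TopologicalSpace Y] [SecondCountableTopology Y] [Nonempty Y] {π : Y → Z} (hπ : Continuous π)
    (ν : Measure Z) [IsFiniteMeasure ν]
    (hfree : Dense {y : Y | MulAction.stabilizer G (π y) = ⊥})
    (hν : ∀ z, MulAction.stabilizer G z = ⊥ → ν {z} = 0) :
    Nonempty (ReplacementScheme G π ν) := by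
  classical
  obtain ⟨F, hFm, hF1, hFex⟩ := exists_monotone_exhaustion G
  obtain ⟨b, hbc, -, hb⟩ := TopologicalSpace.exists_countable_basis Y
  have : Countable b := hbc.to_subtype
  have : Nonempty b := by
    obtain ⟨y⟩ := ‹Nonempty Y›
    obtain ⟨V, hV, -⟩ := hb.exists_subset_of_mem_open (Set.mem_univ y) isOpen_univ
    exact ⟨⟨V, hV⟩⟩
  obtain ⟨e, he⟩ := exists_surjective_nat (b × Finset G)
  -- Unpairing repeats every target at arbitrarily large indices, where `F i` contains the
  -- prescribed finite set.
  let tgt : ℕ → Set Y × Finset G := fun i => ((e i.unpair.1).1.1, (e i.unpair.1).2)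
  obtain ⟨u, hu⟩ := exists_seq_of_forall_initial
    (fun i (v : (k : ℕ) → k < i → Stage G Z Y) s => IsStage F tgt π ν i v s)
    (fun i v hv => exists_isStage F tgt (fun i => hb.isOpen (e i.unpair.1).1.2) hπ ν hfree hν i v hv)
  refine ⟨⟨F, fun i => (u i).y, fun i => (u i).D, fun i => (u i).C, fun i => (u i).B,
    fun i => (u i).L, IsStage.displacement π u, hFm, hFex, fun m => (hu m).flow.1,
    fun m i g l hl => IsStage.displacement_mem hu m i g hl, fun i => (hu i).isClopen,
    fun i g hg g' hg' z h h' => IsStage.eq_of_mem hu i hg hg' h h', fun i => (hu i).dist_lt,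
    fun i => (hu i).measure_le, ?_, IsStage.card_le hu⟩⟩
  intro y₀ V hV hy₀ F' hF'
  obtain ⟨V', hV', hyV', hV'V⟩ := hb.exists_subset_of_mem_open hy₀ hV
  obtain ⟨n, hn⟩ := he (⟨V', hV'⟩, F')
  obtain ⟨N, hN⟩ : ∃ N, F' ⊆ F N := by
    choose m hm using hFex
    refine ⟨F'.sup m, fun f hf => hFm (Finset.le_sup hf) (hm f)⟩
  set i := Nat.pair n N
  have hi : N ≤ i := Nat.right_le_pair n N
  have htgt : tgt i = (V', F') := by simp [tgt, i, hn]
  have h := (hu i).target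
  rw [htgt] at h
  obtain ⟨h1, h2⟩ := h ⟨y₀, hyV', fun f hf k _ d hd => hF' f hf k d hd⟩
  exact ⟨i, hV'V h1, (hu i).mem_C, fun ζ hζ f hf => IsStage.isLocated_of_target hu i (hF1 i) hFm
    (hFm hi (hN hf)) (h2 f hf) hζ⟩

end Existence

/-! ### Unique ergodicity of the equicontinuous system -/

section InvariantMeasure
open scoped Uniformity

/-- A `G`-invariant equivalence relation with open classes. -/
structure IsInvariantOpenSetoid (G : Type*) {Z : Type*} [Group G] [MulAction G Z]
    [TopologicalSpace Z] (r : Setoid Z) : Prop where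
  smul : ∀ (g : G) {z z' : Z}, r z z' → r (g • z) (g • z')
  isOpen : ∀ z, IsOpen {w | r z w}

theorem IsClopen.eventually_uniformity_mem_iff {Z : Type*} [UniformSpace Z] [CompactSpace Z]
    {C : Set Z} (hC : IsClopen C) : ∀ᶠ p : Z × Z in 𝓤 Z, (p.1 ∈ C ↔ p.2 ∈ C) := by
  rw [← nhdsSet_diagonal_eq_uniformity]
  have : {p : Z × Z | p.1 ∈ C ↔ p.2 ∈ C} = C ×ˢ C ∪ Cᶜ ×ˢ Cᶜ := by
    ext p
    simp only [Set.mem_ofPred_eq, Set.mem_union, Set.mem_prod, Set.mem_compl_iff]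
    tauto
  refine IsOpen.mem_nhdsSet (this ▸ (hC.isOpen.prod hC.isOpen).union
    (hC.compl.isOpen.prod hC.compl.isOpen)) |>.2 ?_
  rintro ⟨z, z'⟩ (h : z = z')
  simp [h]

/-- Identify points all of whose translates meet the same members of a fine clopen cover.
Equicontinuity makes this relation an entourage, so its classes are open. -/
theorem exists_isInvariantOpenSetoid {G Z : Type*} [Group G] [MetricSpace Z] [CompactSpace Z]
    [TotallyDisconnectedSpace Z] [MulAction G Z] (heq : IsEquicontinuousAction G Z) {ε : ℝ}
    (hε : 0 < ε) :
    ∃ r : Setoid Z, IsInvariantOpenSetoid G r ∧ ∀ z z', r z z' → dist z z' < ε := by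
  have hc : ∀ z : Z, ∃ C : Set Z, IsClopen C ∧ z ∈ C ∧ C ⊆ Metric.ball z (ε / 2) := fun z =>
    compact_exists_isClopen_in_isOpen Metric.isOpen_ball (Metric.mem_ball_self (by positivity))
  choose C hC hzC hCb using hc
  obtain ⟨t, ht⟩ := isCompact_univ.elim_finite_subcover C (fun z => (hC z).isOpen)
    (fun z _ => Set.mem_iUnion.2 ⟨z, hzC z⟩)
  let r : Setoid Z :=
    { r := fun z z' => ∀ g : G, ∀ c ∈ t, (g • z ∈ C c ↔ g • z' ∈ C c)
      iseqv := ⟨fun _ _ _ _ => Iff.rfl, fun h g c hc => (h g c hc).symm,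
        fun h h' g c hc => (h g c hc).trans (h' g c hc)⟩ }
  have hmem : ∀ᶠ p : Z × Z in 𝓤 Z, r p.1 p.2 := by
    have h1 : ∀ᶠ p : Z × Z in 𝓤 Z, ∀ c ∈ t, (p.1 ∈ C c ↔ p.2 ∈ C c) :=
      (Filter.eventually_all_finset t).2 fun c _ => (hC c).eventually_uniformity_mem_iff
    filter_upwards [heq _ h1] with p hp g c hc using hp g c hc
  refine ⟨r, ⟨fun g z z' h g' c hc => ?_, fun z => ?_⟩, fun z z' h => ?_⟩
  · simpa [smul_smul] using h (g' * g) c hc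
  · rw [isOpen_iff_mem_nhds]
    intro w hw
    filter_upwards [mem_nhds_left w hmem] with w' hw'
    exact r.trans hw hw'
  · obtain ⟨c, hct, hz⟩ := Set.mem_iUnion₂.1 (ht (Set.mem_univ z))
    have hz' : z' ∈ C c := by simpa using (h 1 c hct).1 (by simpa using hz)
    have h1 := hCb c hz
    have h2 := hCb c hz'
    rw [Metric.mem_ball] at h1 h2
    calc dist z z' ≤ dist z c + dist z' c := dist_triangle_right _ _ _
      _ < ε := by linarith

theorem IsInvariantOpenSetoid.finite {G Z : Type*} [Group G] [MulAction G Z] [TopologicalSpace Z]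
    [CompactSpace Z] {r : Setoid Z} (h : IsInvariantOpenSetoid G r) : Finite (Quotient r) := by
  obtain ⟨t, ht⟩ := isCompact_univ.elim_finite_subcover (fun z => {w | r z w}) h.isOpen
    (fun z _ => Set.mem_iUnion.2 ⟨z, r.refl z⟩)
  refine Finite.of_surjective (fun c : t => (Quotient.mk r c.1)) fun q => ?_
  obtain ⟨z, rfl⟩ := Quotient.exists_rep q
  obtain ⟨c, hc, hz⟩ := Set.mem_iUnion₂.1 (ht (Set.mem_univ z))
  exact ⟨⟨c, hc⟩, Quotient.sound hz⟩

/-- All classes of `r` have the same measure. -/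
def HasEqualClasses {Z : Type*} [MeasurableSpace Z] (r : Setoid Z) (μ : Measure Z) : Prop :=
  ∀ z z', μ.real {w | r z w} = μ.real {w | r z' w}

theorem IsInvariantOpenSetoid.preimage_class {G Z : Type*} [Group G] [MulAction G Z]
    [TopologicalSpace Z] {r : Setoid Z} (h : IsInvariantOpenSetoid G r) (g : G) (z : Z) :
    (fun w => g • w) ⁻¹' {w | r z w} = {w | r (g⁻¹ • z) w} := by
  ext w
  constructor
  · intro hw
    simpa using h.smul g⁻¹ hw
  · intro hw
    simpa using h.smul g hw

/-- By minimality G permutes the classes transitively. -/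
theorem IsInvariantOpenSetoid.hasEqualClasses {G Z : Type*} [Group G] [MulAction G Z]
    [TopologicalSpace Z] [MeasurableSpace Z] [BorelSpace Z] [MulAction.IsMinimal G Z]
    {r : Setoid Z} (h : IsInvariantOpenSetoid G r) (μ : Measure Z)
    (hμ : SMulInvariantMeasure G Z μ) : HasEqualClasses r μ := by
  intro z z'
  obtain ⟨g, hg⟩ := (h.isOpen z').exists_smul_mem G z ⟨z', r.refl z'⟩
  have h1 : {w | r z' w} = {w | r (g • z) w} := by
    ext w; exact ⟨fun hw => r.trans (r.symm hg) hw, fun hw => r.trans hg hw⟩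
  have h2 := h.preimage_class g (g • z)
  rw [inv_smul_smul] at h2
  rw [h1, ← h2, Measure.real, Measure.real,
    hμ.measure_preimage_smul g (h.isOpen _).measurableSet]

theorem IsInvariantOpenSetoid.hasEqualClasses_map {G Z : Type*} [Group G] [MulAction G Z]
    [TopologicalSpace Z] [MeasurableSpace Z] [BorelSpace Z] [ContinuousConstSMul G Z]
    {r : Setoid Z} (h : IsInvariantOpenSetoid G r) {μ : Measure Z} (hμ : HasEqualClasses r μ)
    (g : G) : HasEqualClasses r (μ.map (fun z => g • z)) := by
  intro z z'
  have hm : Measurable fun z : Z => g • z := (continuous_const_smul g).measurable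
  rw [map_measureReal_apply hm (h.isOpen _).measurableSet,
    map_measureReal_apply hm (h.isOpen _).measurableSet, h.preimage_class, h.preimage_class]
  exact hμ _ _

/-- Both integrals are within `η` of the average of `f` over representatives of the finitely many
classes. -/
theorem IsInvariantOpenSetoid.abs_integral_sub_le {G Z : Type*} [Group G] [MulAction G Z]
    [MetricSpace Z] [CompactSpace Z] [MeasurableSpace Z] [BorelSpace Z] {r : Setoid Z}
    (h : IsInvariantOpenSetoid G r) {μ μ' : Measure Z} [IsProbabilityMeasure μ]
    [IsProbabilityMeasure μ'] (hμ : HasEqualClasses r μ) (hμ' : HasEqualClasses r μ')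
    {f : Z → ℝ} (hf : Continuous f) {η : ℝ} (hη : ∀ z z', r z z' → |f z - f z'| ≤ η) :
    |∫ z, f z ∂μ - ∫ z, f z ∂μ'| ≤ 2 * η := by
  have := h.finite
  have := Fintype.ofFinite (Quotient r)
  let _ : MeasurableSpace (Quotient r) := ⊤
  have hmk : ∀ q : Quotient r, Quotient.mk r ⁻¹' {q} = {w | r q.out w} := by
    intro q; ext w
    simp only [Set.mem_preimage, Set.mem_singleton_iff]
    constructor
    · rintro rfl; exact Quotient.mk_out w
    · intro hw; rw [← Quotient.out_eq q]; exact Quotient.sound (r.symm hw)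
  have hmeas : Measurable (Quotient.mk r) := measurable_to_countable' fun q => by
    rw [hmk]; exact (h.isOpen _).measurableSet
  have hval : ∀ μ : Measure Z, IsProbabilityMeasure μ → HasEqualClasses r μ → ∀ q : Quotient r,
      (μ.map (Quotient.mk r)).real {q} = (Fintype.card (Quotient r) : ℝ)⁻¹ := by
    intro μ _ hμ q
    have hP : IsProbabilityMeasure (μ.map (Quotient.mk r)) :=
      Measure.isProbabilityMeasure_map hmeas.aemeasurable
    have hs : ∑ q' : Quotient r, (μ.map (Quotient.mk r)).real {q'} = 1 := by
      rw [sum_measureReal_singleton]; simp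
    have hall : ∀ q' : Quotient r, (μ.map (Quotient.mk r)).real {q'} =
        (μ.map (Quotient.mk r)).real {q} := by
      intro q'
      rw [map_measureReal_apply hmeas (measurableSet_singleton _),
        map_measureReal_apply hmeas (measurableSet_singleton _), hmk, hmk]
      exact hμ _ _
    simp only [hall, Finset.sum_const, Finset.card_univ, nsmul_eq_mul] at hs
    exact eq_inv_of_mul_eq_one_right hs
  have hint : ∀ μ : Measure Z, IsProbabilityMeasure μ → HasEqualClasses r μ →
      |∫ z, f z ∂μ - ∑ q : Quotient r, (Fintype.card (Quotient r) : ℝ)⁻¹ * f q.out| ≤ η := by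
    intro μ hPμ hμ
    have h1 : ∫ z, f ((Quotient.mk r z).out) ∂μ =
        ∑ q : Quotient r, (Fintype.card (Quotient r) : ℝ)⁻¹ * f q.out := by
      have hP : IsProbabilityMeasure (μ.map (Quotient.mk r)) :=
        Measure.isProbabilityMeasure_map hmeas.aemeasurable
      rw [← integral_map (f := fun q : Quotient r => f q.out) hmeas.aemeasurable
        (measurable_of_finite _).aestronglyMeasurable, integral_fintype .of_finite]
      simp [hval μ hPμ hμ]
    have hi1 : Integrable f μ := hf.integrable_of_hasCompactSupport
      (HasCompactSupport.of_compactSpace f)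
    have hi2 : Integrable (fun z => f ((Quotient.mk r z).out)) μ := by
      have hP : IsProbabilityMeasure (μ.map (Quotient.mk r)) :=
        Measure.isProbabilityMeasure_map hmeas.aemeasurable
      exact (Integrable.of_finite (f := fun q : Quotient r => f q.out)).comp_measurable hmeas
    rw [← h1, ← integral_sub hi1 hi2]
    have h2 := norm_integral_le_of_norm_le_const (μ := μ)
      (f := fun z => f z - f ((Quotient.mk r z).out)) (C := η)
      (Filter.Eventually.of_forall fun z => hη _ _ (r.symm (Quotient.mk_out z)))
    simpa using h2
  have e1 := hint μ inferInstance hμ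
  have e2 := hint μ' inferInstance hμ'
  rw [abs_le] at e1 e2 ⊢
  constructor <;> linarith [e1.1, e1.2, e2.1, e2.2]

theorem IsInvariantOpenSetoid.exists_hasEqualClasses {G Z : Type*} [Group G] [MulAction G Z]
    [TopologicalSpace Z] [CompactSpace Z] [Nonempty Z] [MeasurableSpace Z] [BorelSpace Z]
    {r : Setoid Z} (h : IsInvariantOpenSetoid G r) :
    ∃ μ : ProbabilityMeasure Z, HasEqualClasses r (μ : Measure Z) := by
  classical
  have := h.finite
  have := Fintype.ofFinite (Quotient r)
  have : Nonempty (Quotient r) := (nonempty_quotient_iff r).2 ‹_›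
  have hc : (Fintype.card (Quotient r) : ENNReal) ≠ 0 := by simp
  let μ : Measure Z := (Fintype.card (Quotient r) : ENNReal)⁻¹ •
    ∑ q : Quotient r, Measure.dirac q.out
  have hμ : IsProbabilityMeasure μ := ⟨by
    simp [μ, ENNReal.inv_mul_cancel hc (by finiteness)]⟩
  refine ⟨⟨μ, hμ⟩, fun z z' => ?_⟩
  have hval : ∀ z, μ.real {w | r z w} = ((Fintype.card (Quotient r) : ENNReal)⁻¹).toReal := by
    intro z
    rw [Measure.real]
    congr 1
    simp only [μ, Measure.smul_apply, Measure.finsetSum_apply, smul_eq_mul]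
    rw [Finset.sum_eq_single (Quotient.mk r z)]
    · rw [Measure.dirac_apply' _ (h.isOpen _).measurableSet, Set.indicator_of_mem]
      · simp
      · exact r.symm (Quotient.mk_out z)
    · intro q _ hq
      rw [Measure.dirac_apply' _ (h.isOpen _).measurableSet, Set.indicator_of_notMem]
      intro hz
      apply hq
      rw [← Quotient.out_eq q]
      exact Quotient.sound (r.symm hz)
    · simp
  exact (hval z).trans (hval z').symm

theorem smulInvariantMeasure_of_integral_eq {G Z : Type*} [Group G] [MulAction G Z]
    [MetricSpace Z] [MeasurableSpace Z] [BorelSpace Z] [ContinuousConstSMul G Z]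
    (μ : Measure Z) [IsFiniteMeasure μ]
    (h : ∀ (g : G) (f : BoundedContinuousFunction Z ℝ), ∫ z, f (g • z) ∂μ = ∫ z, f z ∂μ) :
    SMulInvariantMeasure G Z μ := by
  refine ⟨fun g s hs => ?_⟩
  have hm : Measurable fun z : Z => g • z := (continuous_const_smul g).measurable
  have : μ.map (fun z => g • z) = μ := by
    refine ext_of_forall_integral_eq_of_IsFiniteMeasure fun f => ?_
    rw [integral_map hm.aemeasurable f.continuous.measurable.aestronglyMeasurable]
    exact h g f
  rw [← Measure.map_apply hm hs, this]

/-- A minimal equicontinuous action on a totally disconnected compact space is uniquely ergodic. -/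
theorem existsUnique_invProbMeasure {G Z : Type*} [Group G] [MetricSpace Z] [CompactSpace Z]
    [TotallyDisconnectedSpace Z] [Nonempty Z] [MeasurableSpace Z] [BorelSpace Z] [MulAction G Z]
    [ContinuousConstSMul G Z] [MulAction.IsMinimal G Z] (heq : IsEquicontinuousAction G Z) :
    ∃ ν : InvProbMeasure G Z, ∀ ν' : InvProbMeasure G Z, ν' = ν := by
  have hmod : ∀ f : Z → ℝ, Continuous f → ∀ η > 0, ∃ N : ℕ, ∀ n ≥ N, ∀ z z' : Z,
      dist z z' < 1 / ((n : ℝ) + 1) → |f z - f z'| ≤ η := by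
    intro f hf η hη
    obtain ⟨δ, hδ, h⟩ := Metric.uniformContinuous_iff.1
      (CompactSpace.uniformContinuous_of_continuous hf) η hη
    obtain ⟨N, hN⟩ := exists_nat_one_div_lt hδ
    refine ⟨N, fun n hn z z' hd => (h (hd.trans_le (le_trans ?_ hN.le))).le⟩
    exact one_div_le_one_div_of_le (by positivity) (by exact_mod_cast Nat.succ_le_succ hn)
  choose r hr hrd using fun n : ℕ => exists_isInvariantOpenSetoid (Z := Z) heq
    (Nat.one_div_pos_of_nat (α := ℝ) (n := n))
  have huniq : ∀ ν ν' : InvProbMeasure G Z, ν = ν' := by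
    intro ν ν'
    have : ν.meas = ν'.meas := by
      refine ext_of_forall_integral_eq_of_IsFiniteMeasure fun f => ?_
      have hle : ∀ η > 0, |∫ z, f z ∂ν.meas - ∫ z, f z ∂ν'.meas| ≤ 2 * η := by
        intro η hη
        obtain ⟨N, hN⟩ := hmod f f.continuous η hη
        exact (hr N).abs_integral_sub_le ((hr N).hasEqualClasses _ ν.2)
          ((hr N).hasEqualClasses _ ν'.2) f.continuous fun z z' hz => hN N le_rfl z z' (hrd N z z' hz)
      have : |∫ z, f z ∂ν.meas - ∫ z, f z ∂ν'.meas| ≤ 0 :=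
        le_of_forall_pos_le_add fun η hη => by simpa using (hle (η / 2) (by positivity)).trans (by linarith)
      exact sub_eq_zero.1 (abs_nonpos_iff.1 this)
    exact Subtype.ext (Subtype.ext this)
  choose μ hμ using fun n => (hr n).exists_hasEqualClasses
  -- Existence: a cluster point of class-uniform measures for finer and finer relations. Their
  -- translates are again class-uniform, so the invariance defect vanishes in the limit.
  obtain ⟨ν, hν⟩ := exists_clusterPt_of_compactSpace (Filter.map μ Filter.atTop)
  refine ⟨⟨ν, smulInvariantMeasure_of_integral_eq _ fun g f => ?_⟩, fun ν' => huniq _ _⟩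
  let fg : BoundedContinuousFunction Z ℝ :=
    f.compContinuous ⟨fun z => g • z, continuous_const_smul g⟩
  have hle : ∀ η > 0, |∫ z, fg z ∂(ν : Measure Z) - ∫ z, f z ∂(ν : Measure Z)| ≤ 2 * η := by
    intro η hη
    obtain ⟨N, hN⟩ := hmod f f.continuous η hη
    have hcl : IsClosed {ρ : ProbabilityMeasure Z |
        |∫ z, fg z ∂(ρ : Measure Z) - ∫ z, f z ∂(ρ : Measure Z)| ≤ 2 * η} :=
      isClosed_le ((ProbabilityMeasure.continuous_integral_boundedContinuousFunction fg).sub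
        (ProbabilityMeasure.continuous_integral_boundedContinuousFunction f)).abs continuous_const
    suffices h : ∀ᶠ ρ : ProbabilityMeasure Z in Filter.map μ Filter.atTop, |∫ z, fg z ∂(ρ : Measure Z) -
        ∫ z, f z ∂(ρ : Measure Z)| ≤ 2 * η from
      hcl.closure_subset (hν.mem_closure_of_mem _ h)
    rw [Filter.eventually_map]
    filter_upwards [Filter.eventually_ge_atTop N] with n hn
    have hm : Measurable fun z : Z => g • z := (continuous_const_smul g).measurable
    have hP : IsProbabilityMeasure ((μ n : Measure Z).map fun z => g • z) :=
      Measure.isProbabilityMeasure_map hm.aemeasurable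
    have h1 := (hr n).abs_integral_sub_le ((hr n).hasEqualClasses_map (hμ n) g) (hμ n)
      f.continuous fun z z' hz => hN n hn z z' (hrd n z z' hz)
    rw [integral_map hm.aemeasurable f.continuous.measurable.aestronglyMeasurable] at h1
    exact h1
  have : |∫ z, fg z ∂(ν : Measure Z) - ∫ z, f z ∂(ν : Measure Z)| ≤ 0 :=
    le_of_forall_pos_le_add fun η hη => by simpa using (hle (η / 2) (by positivity)).trans (by linarith)
  exact sub_eq_zero.1 (abs_nonpos_iff.1 this)

theorem measure_singleton_eq_zero_of_stabilizer_eq_bot {G Z : Type*} [Group G] [Infinite G]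
    [MulAction G Z] [MeasurableSpace Z] [MeasurableSingletonClass Z] (μ : Measure Z)
    [IsFiniteMeasure μ] (hμ : SMulInvariantMeasure G Z μ) {z : Z}
    (hz : MulAction.stabilizer G z = ⊥) : μ {z} = 0 := by
  by_contra hne
  have hinj : Function.Injective fun g : G => g • z := by
    intro g h hgh
    have : h⁻¹ * g ∈ MulAction.stabilizer G z := by
      rw [MulAction.mem_stabilizer_iff, mul_smul]
      exact inv_smul_eq_iff.2 hgh
    rw [hz, Subgroup.mem_bot, inv_mul_eq_one] at this
    exact this.symm
  have hfin := Measure.finite_const_le_meas_of_disjoint_iUnion μ (ε := μ {z})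
    (pos_iff_ne_zero.2 hne) (As := fun g : G => {g • z}) (fun g => measurableSet_singleton _)
    (fun g h hgh => Set.disjoint_singleton.2 (hinj.ne hgh)) (by finiteness)
  refine Set.infinite_univ (α := G) (hfin.subset fun g _ => ?_)
  have := hμ.measure_preimage_smul g (measurableSet_singleton (g • z))
  rw [Set.mem_ofPred_eq, ← this]
  exact measure_mono (by simp)

end InvariantMeasure

namespace ReplacementScheme

/-! ### Towers and core of a scheme -/

section Base

variable {G Z Y : Type*} [Group G] [MulAction G Z] [MetricSpace Z] [MeasurableSpace Z]
  [TopologicalSpace Y] {π : Y → Z} {ν : Measure Z} (σ : ReplacementScheme G π ν)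

/-- The union of the towers. -/
def towers : Set Z := {z | ∃ i g, IsLocated σ.D σ.C z i g}

/-- The points whose orbit stays in the towers. -/
def core : Set Z := {z | ∀ g : G, g • z ∈ σ.towers}

variable {σ}

theorem exists_isLocated_le {z : Z} {i : ℕ} {g : G} (hg : g ∈ σ.D i) (hz : g⁻¹ • z ∈ σ.C i) :
    ∃ j ≤ i, ∃ h, IsLocated σ.D σ.C z j h := by
  classical
  have hex : ∃ j, ∃ h ∈ σ.D j, h⁻¹ • z ∈ σ.C j := ⟨i, g, hg, hz⟩
  obtain ⟨h, hh, hz'⟩ := Nat.find_spec hex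
  refine ⟨Nat.find hex, Nat.find_min' hex ⟨g, hg, hz⟩, h, hh, hz', fun k hk d hd hdk => ?_⟩
  exact Nat.find_min hex hk ⟨d, hd, hdk⟩

theorem le_of_isLocated {z : Z} {i j : ℕ} {g h : G} (hz : IsLocated σ.D σ.C z i g)
    (hh : h ∈ σ.D j) (hz' : h⁻¹ • z ∈ σ.C j) : i ≤ j :=
  not_lt.1 fun hlt => hz.2.2 j hlt h hh hz'

theorem isLocated_unique {z : Z} {i j : ℕ} {g h : G} (hz : IsLocated σ.D σ.C z i g)
    (hz' : IsLocated σ.D σ.C z j h) : i = j ∧ g = h := by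
  obtain rfl : i = j := le_antisymm (le_of_isLocated hz hz'.1 hz'.2.1)
    (le_of_isLocated hz' hz.1 hz.2.1)
  exact ⟨rfl, σ.disjoint i g hz.1 h hz'.1 z hz.2.1 hz'.2.1⟩

theorem not_mem_of_not_mem_towers {z : Z} (hz : z ∉ σ.towers) {i : ℕ} {g : G} (hg : g ∈ σ.D i) :
    g⁻¹ • z ∉ σ.C i := fun h =>
  let ⟨j, _, k, hk⟩ := exists_isLocated_le hg h
  hz ⟨j, k, hk⟩

theorem smul_mem_core {z : Z} (hz : z ∈ σ.core) (g : G) : g • z ∈ σ.core := fun h => by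
  rw [smul_smul]; exact hz _

theorem smul_mem_core_iff {z : Z} (g : G) : g • z ∈ σ.core ↔ z ∈ σ.core :=
  ⟨fun h => by simpa using smul_mem_core h g⁻¹, fun h => smul_mem_core h g⟩

variable (σ)

/-- The union of the towers of index less than `N`. -/
def towersBelow (N : ℕ) : Set Z := ⋃ i ∈ Finset.range N, ⋃ g ∈ σ.D i, {z | g⁻¹ • z ∈ σ.C i}

theorem towersBelow_subset (N : ℕ) : σ.towersBelow N ⊆ σ.towers := by
  intro z hz
  simp only [towersBelow, Set.mem_iUnion] at hz
  obtain ⟨i, _, g, hg, hz⟩ := hz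
  obtain ⟨j, -, h, hh⟩ := exists_isLocated_le hg hz
  exact ⟨j, h, hh⟩

theorem le_of_not_mem_towersBelow {N : ℕ} {z : Z} (hz : z ∉ σ.towersBelow N) {i : ℕ} {g : G}
    (h : IsLocated σ.D σ.C z i g) : N ≤ i := by
  by_contra hi
  apply hz
  simp only [towersBelow, Set.mem_iUnion]
  exact ⟨i, Finset.mem_range.2 (not_le.1 hi), g, h.1, h.2.1⟩

/-- Near a point outside all towers the window property supplies the base of one. -/
theorem dense_towers (hπ : Continuous π) (hs : Function.Surjective π) : Dense σ.towers := by
  rw [dense_iff_inter_open]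
  rintro O hO ⟨z, hz⟩
  obtain ⟨y₀, rfl⟩ := hs z
  by_cases hy : π y₀ ∈ σ.towers
  · exact ⟨_, hz, hy⟩
  · obtain ⟨i, hi, hC, h⟩ := σ.exists_window y₀ (π ⁻¹' O) (hO.preimage hπ) hz {1} (by
      intro f hf k d hd
      rw [Finset.mem_singleton.1 hf, one_smul]
      exact not_mem_of_not_mem_towers hy hd)
    refine ⟨π (σ.y i), hi, i, 1, ?_⟩
    simpa using (h _ hC 1 (by simp)).1

/-- Tail of the geometric series in `measure_le`; for `N = 0` the bound is 1/2. -/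
theorem measure_towers_diff_le [BorelSpace Z] (hν : SMulInvariantMeasure G Z ν) (N : ℕ) :
    ν (σ.towers \ σ.towersBelow N) ≤ (2⁻¹ : ENNReal) ^ (N + 1) := by
  have hsub : σ.towers \ σ.towersBelow N ⊆
      ⋃ i : ℕ, ⋃ g ∈ σ.D (i + N), (fun z => g⁻¹ • z) ⁻¹' σ.C (i + N) := by
    rintro z ⟨⟨i, g, h⟩, hz⟩
    obtain ⟨j, rfl⟩ := Nat.exists_eq_add_of_le' (σ.le_of_not_mem_towersBelow hz h)
    simp only [Set.mem_iUnion]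
    exact ⟨j, g, h.1, h.2.1⟩
  calc ν (σ.towers \ σ.towersBelow N)
      ≤ ∑' i : ℕ, ν (⋃ g ∈ σ.D (i + N), (fun z => g⁻¹ • z) ⁻¹' σ.C (i + N)) :=
        (measure_mono hsub).trans (measure_iUnion_le _)
    _ ≤ ∑' i : ℕ, (2⁻¹ : ENNReal) ^ (N + 2) * 2⁻¹ ^ i := by
        refine ENNReal.tsum_le_tsum fun i => ?_
        calc _ ≤ ∑ g ∈ σ.D (i + N), ν ((fun z => g⁻¹ • z) ⁻¹' σ.C (i + N)) :=
              measure_biUnion_finset_le _ _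
          _ = (σ.D (i + N)).card * ν (σ.C (i + N)) := by
              rw [Finset.sum_congr rfl fun g _ => hν.measure_preimage_smul g⁻¹
                (σ.isClopen _).isOpen.measurableSet, Finset.sum_const, nsmul_eq_mul]
          _ ≤ _ := (σ.measure_le _).trans_eq (by rw [← pow_add]; congr 1; ring)
    _ = (2⁻¹ : ENNReal) ^ (N + 1) := by
        rw [ENNReal.tsum_mul_left, ENNReal.tsum_geometric, ENNReal.one_sub_inv_two, inv_inv,
          pow_succ _ (N + 1), mul_assoc, ENNReal.inv_mul_cancel (by simp) (by simp), mul_one]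

variable [ContinuousConstSMul G Z]

theorem isClopen_isLocated (h : G) (i : ℕ) (g : G) :
    IsClopen {z : Z | IsLocated σ.D σ.C (h • z) i g} := by
  have hcl : ∀ (k : ℕ) (d : G), IsClopen {z : Z | d⁻¹ • h • z ∈ σ.C k} := fun k d =>
    (σ.isClopen k).preimage ((continuous_const_smul _).comp (continuous_const_smul _))
  by_cases hg : g ∈ σ.D i
  · have : {z : Z | IsLocated σ.D σ.C (h • z) i g} = {z : Z | g⁻¹ • h • z ∈ σ.C i} ∩
        ⋂ k ∈ Finset.range i, ⋂ d ∈ σ.D k, {z : Z | d⁻¹ • h • z ∈ σ.C k}ᶜ := by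
      ext z; simp [IsLocated, hg]
    rw [this]
    exact (hcl i g).inter (isClopen_biInter_finset fun k _ => isClopen_biInter_finset fun d _ =>
      (hcl k d).compl)
  · simp [IsLocated, hg, isClopen_empty]

theorem isOpen_towers : IsOpen σ.towers := by
  have : σ.towers = ⋃ i, ⋃ g : G, {z | IsLocated σ.D σ.C ((1 : G) • z) i g} := by
    ext z; simp [towers]
  rw [this]
  exact isOpen_iUnion fun i => isOpen_iUnion fun g => (σ.isClopen_isLocated 1 i g).isOpen

theorem isClopen_towersBelow (N : ℕ) : IsClopen (σ.towersBelow N) :=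
  isClopen_biUnion_finset fun i _ => isClopen_biUnion_finset fun _ _ =>
    (σ.isClopen i).preimage (continuous_const_smul _)

theorem dense_core [Countable G] [CompactSpace Z] (hπ : Continuous π)
    (hs : Function.Surjective π) : Dense σ.core := by
  have : σ.core = ⋂ g : G, (fun z => g • z) ⁻¹' σ.towers := by
    ext z; simp [core]
  rw [this]
  refine dense_iInter_of_isOpen (fun g => σ.isOpen_towers.preimage (continuous_const_smul g))
    fun g => ?_
  exact (σ.dense_towers hπ hs).preimage (isOpenMap_smul g)

theorem measurableSet_core [Countable G] [BorelSpace Z] : MeasurableSet σ.core := by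
  have : σ.core = ⋂ g : G, (fun z => g • z) ⁻¹' σ.towers := by
    ext z; simp [core]
  rw [this]
  exact MeasurableSet.iInter fun g =>
    (σ.isOpen_towers.preimage (continuous_const_smul g)).measurableSet

end Base

end ReplacementScheme

/-! ### The almost one-to-one extension -/

/-- A point of `Y` together with marks, indexed by level, slot and displacement. -/
abbrev MarkedPoint (G Y : Type*) : Type _ := Y × (ℕ × ℕ × G → Bool)

namespace ReplacementScheme

/-- The translation of `Z × (G → MarkedPoint G Y)` by `g`. -/
def shift {G Z Y : Type*} [Group G] [MulAction G Z] (g : G)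
    (x : Z × (G → MarkedPoint G Y)) : Z × (G → MarkedPoint G Y) :=
  (g • x.1, fun h => x.2 (h * g))

theorem continuous_shift {G Z Y : Type*} [Group G] [MulAction G Z] [TopologicalSpace Z]
    [TopologicalSpace Y] [ContinuousConstSMul G Z] (g : G) :
    Continuous (shift (Z := Z) (Y := Y) g) := by
  unfold shift
  refine Continuous.prodMk (continuous_fst.const_smul g) ?_
  exact continuous_pi fun h => (continuous_apply (h * g)).comp continuous_snd

section Code
open Classical in
/-- The content of the point `g` of the `i`-th tower. -/
noncomputable def label {G Z Y : Type*} [Group G] [MulAction G Z] [MetricSpace Z]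
    [MeasurableSpace Z] [TopologicalSpace Y] [SMul G Y] {π : Y → Z} {ν : Measure Z}
    (σ : ReplacementScheme G π ν) (i : ℕ) (g : G) : MarkedPoint G Y :=
  (g • σ.y i, fun p => decide
    (p.1 ≤ i ∧ p.2.1 < σ.L p.1 ∧ IsCut (σ.F p.1) (σ.D i) g ∧ σ.δ p.1 i g p.2.1 = p.2.2))

open Classical in
/-- The content of `z` if `z` is in a tower of index less than `N`, and `y` without marks
otherwise. -/
noncomputable def code {G Z Y : Type*} [Group G] [MulAction G Z] [MetricSpace Z]
    [MeasurableSpace Z] [TopologicalSpace Y] [SMul G Y] {π : Y → Z} {ν : Measure Z}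
    (σ : ReplacementScheme G π ν) (N : ℕ∞) (y : Y) (z : Z) : MarkedPoint G Y :=
  if h : ∃ p : ℕ × G, (p.1 : ℕ∞) < N ∧ IsLocated σ.D σ.C z p.1 p.2 then
    σ.label h.choose.1 h.choose.2 else (y, fun _ => false)

variable {G Z Y : Type*} [Group G] [MulAction G Z] [MetricSpace Z] [MeasurableSpace Z]
  [TopologicalSpace Y] [MulAction G Y] {π : Y → Z} {ν : Measure Z} {σ : ReplacementScheme G π ν}

theorem code_of_isLocated {N : ℕ∞} {y : Y} {z : Z} {i : ℕ} {g : G} (hi : (i : ℕ∞) < N)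
    (h : IsLocated σ.D σ.C z i g) : σ.code N y z = σ.label i g := by
  have hex : ∃ p : ℕ × G, (p.1 : ℕ∞) < N ∧ IsLocated σ.D σ.C z p.1 p.2 := ⟨(i, g), hi, h⟩
  have hu := isLocated_unique h hex.choose_spec.2
  rw [code, dif_pos hex, ← hu.1, ← hu.2]

theorem code_of_forall_not {N : ℕ∞} {y : Y} {z : Z}
    (h : ∀ (i : ℕ) g, (i : ℕ∞) < N → ¬ IsLocated σ.D σ.C z i g) :
    σ.code N y z = (y, fun _ => false) :=
  dif_neg fun ⟨p, hp, hz⟩ => h p.1 p.2 hp hz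

theorem code_of_not_mem {N : ℕ∞} {y : Y} {z : Z} (h : z ∉ σ.towers) :
    σ.code N y z = (y, fun _ => false) :=
  code_of_forall_not fun i g _ hz => h ⟨i, g, hz⟩

theorem label_snd_eq_true {i : ℕ} {g : G} {m l : ℕ} {k : G} :
    (σ.label i g).2 (m, l, k) = true ↔
      m ≤ i ∧ l < σ.L m ∧ IsCut (σ.F m) (σ.D i) g ∧ σ.δ m i g l = k := by
  simp [label]

variable (σ)

/-- The point of `Z × (G → MarkedPoint G Y)` over `π y` whose coordinate at `h` is the content of
`h • π y` in the towers of index less than `N`. -/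
noncomputable def array (N : ℕ∞) (y : Y) : Z × (G → MarkedPoint G Y) :=
  (π y, fun h => σ.code N (h • y) (h • π y))

/-- The almost one-to-one extension of `Z` defined by the scheme. -/
def Space : Type _ :=
  {x : Z × (G → MarkedPoint G Y) // x ∈ closure (σ.array ⊤ '' {y | π y ∈ σ.core})}

instance : TopologicalSpace σ.Space := instTopologicalSpaceSubtype

instance [CompactSpace Z] [CompactSpace Y] : CompactSpace σ.Space :=
  isCompact_iff_compactSpace.1 isClosed_closure.isCompact

instance [T2Space Y] : T2Space σ.Space := inferInstanceAs (T2Space (Subtype _))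

instance [T3Space Y] : T3Space σ.Space := inferInstanceAs (T3Space (Subtype _))

instance [TotallyDisconnectedSpace Z] [TotallyDisconnectedSpace Y] :
    TotallyDisconnectedSpace σ.Space := inferInstanceAs (TotallyDisconnectedSpace (Subtype _))

instance [Countable G] [SecondCountableTopology Z] [SecondCountableTopology Y] :
    SecondCountableTopology σ.Space := inferInstanceAs (SecondCountableTopology (Subtype _))

instance : MeasurableSpace σ.Space := borel _

instance : BorelSpace σ.Space := ⟨rfl⟩

theorem shift_array (hπ : IsEquivariant G π) (N : ℕ∞) (g : G) (y : Y) :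
    shift g (σ.array N y) = σ.array N (g • y) := by
  simp [shift, array, hπ g y, mul_smul]

theorem shift_mem [ContinuousConstSMul G Z] (hπ : IsEquivariant G π) (g : G)
    {x : Z × (G → MarkedPoint G Y)} (hx : x ∈ closure (σ.array ⊤ '' {y | π y ∈ σ.core})) :
    shift g x ∈ closure (σ.array ⊤ '' {y | π y ∈ σ.core}) := by
  refine map_mem_closure (continuous_shift g) hx ?_
  rintro _ ⟨y, hy, rfl⟩
  exact ⟨g • y, by simpa [hπ g y] using smul_mem_core hy g, (σ.shift_array hπ ⊤ g y).symm⟩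

/-- The action of `G` by translations. -/
@[reducible] def mulAction [ContinuousConstSMul G Z] (hπ : IsEquivariant G π) :
    MulAction G σ.Space where
  smul g x := ⟨shift g x.1, σ.shift_mem hπ g x.2⟩
  one_smul x := Subtype.ext (by
    change shift 1 x.1 = x.1
    simp [shift])
  mul_smul g h x := Subtype.ext (by
    change shift (g * h) x.1 = shift g (shift h x.1)
    simp [shift, mul_smul, mul_assoc])

theorem continuousConstSMul [ContinuousConstSMul G Z] (hπ : IsEquivariant G π) :
    let _ := σ.mulAction hπ
    ContinuousConstSMul G σ.Space :=
  let _ := σ.mulAction hπ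
  ⟨fun g => ((continuous_shift g).comp continuous_subtype_val).subtype_mk _⟩

/-- The projection to `Z`. -/
def toBase (x : σ.Space) : Z := x.1.1

theorem continuous_toBase : Continuous σ.toBase := continuous_fst.comp continuous_subtype_val

variable {σ}

/-- A closed property of the points over the core holds on all of `Space`. -/
theorem Space.induction {P : Z × (G → MarkedPoint G Y) → Prop} (hP : IsClosed {x | P x})
    (h : ∀ y, π y ∈ σ.core → P (σ.array ⊤ y)) (x : σ.Space) : P x.1 :=
  closure_minimal (by rintro _ ⟨y, hy, rfl⟩; exact h y hy) hP x.2

theorem eq_label_of_isLocated [ContinuousConstSMul G Z] [T2Space Y] (x : σ.Space) {h g : G} {i : ℕ}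
    (hx : IsLocated σ.D σ.C (h • σ.toBase x) i g) : x.1.2 h = σ.label i g := by
  refine Space.induction (σ := σ)
    (P := fun x => IsLocated σ.D σ.C (h • x.1) i g → x.2 h = σ.label i g) ?_ ?_ x hx
  · refine isClosed_imp ?_ ?_
    · exact (σ.isClopen_isLocated h i g).isOpen.preimage continuous_fst
    · exact isClosed_eq ((continuous_apply h).comp continuous_snd) continuous_const
  · exact fun y _ hy => code_of_isLocated (by simp) hy

theorem eq_array_of_mem_core [ContinuousConstSMul G Z] [T2Space Y] (x : σ.Space) {y : Y}
    (hx : σ.toBase x = π y) (hy : π y ∈ σ.core) : x.1 = σ.array ⊤ y := by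
  refine Prod.ext hx (funext fun h => ?_)
  obtain ⟨i, g, hl⟩ := hy h
  rw [eq_label_of_isLocated x (hx ▸ hl)]
  exact (code_of_isLocated (by simp) hl).symm

theorem surjective_toBase [ContinuousConstSMul G Z] [CompactSpace Z] [CompactSpace Y] [Countable G]
    (hπ : Continuous π) (hs : Function.Surjective π) : Function.Surjective σ.toBase := by
  rw [← Set.range_eq_univ, ← (isCompact_range σ.continuous_toBase).isClosed.closure_eq]
  refine ((σ.dense_core hπ hs).mono fun z hz => ?_).closure_eq
  obtain ⟨y, rfl⟩ := hs z
  exact ⟨⟨σ.array ⊤ y, subset_closure ⟨y, hz, rfl⟩⟩, rfl⟩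

theorem dense_range_core :
    Dense {x : σ.Space | ∃ y, π y ∈ σ.core ∧ x.1 = σ.array ⊤ y} := by
  intro x
  refine closure_subtype.2 (closure_mono ?_ x.2)
  rintro _ ⟨y, hy, rfl⟩
  exact ⟨⟨σ.array ⊤ y, subset_closure ⟨y, hy, rfl⟩⟩, ⟨y, hy, rfl⟩, rfl⟩

/-- A nonempty closed invariant set projects onto Z, so it contains the only point over each core
point, and these points are dense. -/
theorem isMinimal [ContinuousConstSMul G Z] [CompactSpace Z] [CompactSpace Y] [T2Space Y]
    (hZ : MulAction.IsMinimal G Z) (hπ : IsEquivariant G π) :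
    let _ := σ.mulAction hπ
    MulAction.IsMinimal G σ.Space := by
  let _ := σ.mulAction hπ
  have := σ.continuousConstSMul hπ
  refine isMinimal_iff_isClosed_smul_invariant G |>.2 fun s hs hinv => ?_
  rcases s.eq_empty_or_nonempty with rfl | hne
  · exact Or.inl rfl
  right
  have himg : σ.toBase '' s = Set.univ := by
    refine ((isMinimal_iff_isClosed_smul_invariant G).1 hZ _
      (hs.isCompact.image σ.continuous_toBase).isClosed fun g => ?_).resolve_left
      (hne.image _).ne_empty
    rintro _ ⟨_, ⟨x, hx, rfl⟩, rfl⟩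
    exact ⟨g • x, hinv g (Set.smul_mem_smul_set hx), rfl⟩
  rw [← hs.closure_eq]
  refine (dense_range_core.mono ?_).closure_eq
  rintro x ⟨y, hy, hx⟩
  obtain ⟨x', hx', hb⟩ := himg.symm ▸ Set.mem_univ (π y)
  rwa [Subtype.ext (hx.trans (eq_array_of_mem_core x' hb hy).symm)]

theorem isAlmostOneToOneFactorMap [ContinuousConstSMul G Z] [CompactSpace Z] [CompactSpace Y]
    [T2Space Y] [Countable G] (hπ : IsFactorMap G π) :
    let _ := σ.mulAction hπ.equivariant
    IsAlmostOneToOneFactorMap G σ.toBase := by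
  let _ := σ.mulAction hπ.equivariant
  refine ⟨⟨fun _ _ => rfl, σ.continuous_toBase, surjective_toBase hπ.continuous hπ.surjective⟩,
    dense_range_core.mono ?_⟩
  rintro x ⟨y, hy, hx⟩
  have hb : σ.toBase x = π y := congrArg Prod.fst hx
  refine Set.eq_singleton_iff_unique_mem.2 ⟨rfl, fun x' hx' => Subtype.ext ?_⟩
  rw [hx, eq_array_of_mem_core x' (hx'.trans hb) hy]

/-- A basic neighbourhood tests finitely many places. Those in towers keep their location nearby.
For the others, the window property gives a tower whose content at `f` is `f • y i` without marks,
with `y i` near `y₀`; core points of its base near `π (y i)` have arrays in the neighbourhood. -/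
theorem array_mem [ContinuousConstSMul G Z] [ContinuousConstSMul G Y] [CompactSpace Z] [Countable G]
    (hπ : Continuous π) (hs : Function.Surjective π) (y₀ : Y) :
    σ.array ⊤ y₀ ∈ closure (σ.array ⊤ '' {y | π y ∈ σ.core}) := by
  classical
  rw [mem_closure_iff]
  intro o ho hy₀
  obtain ⟨u, v, hu, hv, hyu, hyv, huv⟩ := isOpen_prod_iff.1 ho _ _ hy₀
  obtain ⟨I, w, hw, hwv⟩ := isOpen_pi_iff.1 hv _ hyv
  -- the set of points of `Z` with the same location as `π y₀` at the visible places of `I`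
  have hvis : ∃ N : Set Z, IsOpen N ∧ π y₀ ∈ N ∧ ∀ h ∈ I, h • π y₀ ∈ σ.towers →
      ∀ z ∈ N, ∃ i g, IsLocated σ.D σ.C (h • z) i g ∧ IsLocated σ.D σ.C (h • π y₀) i g := by
    have : ∀ h : G, ∃ N : Set Z, IsOpen N ∧ π y₀ ∈ N ∧ (h • π y₀ ∈ σ.towers →
        ∀ z ∈ N, ∃ i g, IsLocated σ.D σ.C (h • z) i g ∧ IsLocated σ.D σ.C (h • π y₀) i g) := by
      intro h
      by_cases hh : h • π y₀ ∈ σ.towers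
      · obtain ⟨i, g, hig⟩ := hh
        exact ⟨_, (σ.isClopen_isLocated h i g).isOpen, hig, fun _ z hz => ⟨i, g, hz, hig⟩⟩
      · exact ⟨Set.univ, isOpen_univ, trivial, fun h' => absurd h' hh⟩
    choose N hN hyN h using this
    exact ⟨⋂ h ∈ I, N h, isOpen_biInter_finset fun h _ => hN h,
      Set.mem_iInter₂.2 fun h _ => hyN h, fun k hk hk' z hz => h k hk' z (Set.mem_iInter₂.1 hz k hk)⟩
  obtain ⟨N, hNo, hyN, hN⟩ := hvis
  set F' := I.filter fun h => h • π y₀ ∉ σ.towers with hF'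
  have hopen : IsOpen (π ⁻¹' (u ∩ N) ∩
      ⋂ h ∈ F', {y : Y | (h • y, fun _ => false) ∈ w h}) := by
    refine ((hu.inter hNo).preimage hπ).inter (isOpen_biInter_finset fun h hh => ?_)
    exact (hw h (Finset.mem_filter.1 hh).1).1.preimage
      ((continuous_const_smul h).prodMk continuous_const)
  obtain ⟨i, ⟨⟨hiu, hiN⟩, hiF⟩, hiC, hloc⟩ := σ.exists_window y₀ _ hopen
    ⟨⟨hyu, hyN⟩, Set.mem_iInter₂.2 fun h hh => by
      obtain ⟨hhI, hh'⟩ := Finset.mem_filter.1 hh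
      have := (hw h hhI).2
      rwa [code_of_not_mem hh'] at this⟩ F'
    (fun f hf k d hd => not_mem_of_not_mem_towers (Finset.mem_filter.1 hf).2 hd)
  obtain ⟨z, ⟨⟨hzu, hzN⟩, hzC⟩, hz⟩ := (σ.dense_core hπ hs).inter_open_nonempty
    ((u ∩ N) ∩ σ.C i) ((hu.inter hNo).inter (σ.isClopen i).isOpen) ⟨_, ⟨hiu, hiN⟩, hiC⟩
  obtain ⟨y, rfl⟩ := hs z
  refine ⟨σ.array ⊤ y, huv ⟨hzu, hwv fun h hh => ?_⟩, y, hz, rfl⟩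
  change σ.code ⊤ (h • y) (h • π y) ∈ w h
  by_cases hhv : h • π y₀ ∈ σ.towers
  · obtain ⟨j, g, h1, h2⟩ := hN h hh hhv _ hzN
    rw [code_of_isLocated (by simp) h1]
    have := (hw h hh).2
    rwa [code_of_isLocated (by simp) h2] at this
  · have hhF : h ∈ F' := Finset.mem_filter.2 ⟨hh, hhv⟩
    obtain ⟨h1, h2⟩ := hloc _ hzC h hhF
    rw [code_of_isLocated (by simp) h1]
    have : σ.label i h = (h • σ.y i, fun _ => false) := by
      refine Prod.ext rfl (funext fun p => ?_)
      rw [← Bool.not_eq_true]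
      intro hp
      obtain ⟨h3, -, h4, -⟩ := label_snd_eq_true.1 hp
      exact h2 _ h3 h4
    rw [this]
    exact Set.mem_iInter₂.1 hiF h hhF

end Code

end ReplacementScheme

/-! ### Marks and regular points -/

namespace ReplacementScheme

section Marks

theorem continuous_bit {G Y : Type*} [TopologicalSpace Y] (p : ℕ × ℕ × G) :
    Continuous fun a : MarkedPoint G Y => if a.2 p = true then 1 else 0 :=
  (continuous_of_discreteTopology (f := fun b : Bool => if b = true then 1 else 0)).comp
    ((continuous_apply p).comp continuous_snd)

theorem isClopen_bit {G Z Y : Type*} [TopologicalSpace Z] [TopologicalSpace Y] (h : G)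
    (p : ℕ × ℕ × G) : IsClopen {x : Z × (G → MarkedPoint G Y) | (x.2 h).2 p = true} :=
  (isClopen_discrete {true}).preimage (f := fun x : Z × (G → MarkedPoint G Y) => (x.2 h).2 p)
    ((continuous_apply p).comp (continuous_snd.comp ((continuous_apply h).comp continuous_snd)))

variable {G Z Y : Type*} [Group G] [MulAction G Z] [MetricSpace Z] [MeasurableSpace Z]
  [TopologicalSpace Y] {π : Y → Z} {ν : Measure Z} {σ : ReplacementScheme G π ν}

/-- The neighbour stays in the `i`-th tower, although an earlier tower may contain it too. -/
theorem isLocated_smul {m i : ℕ} {g f : G} {z : Z} (hz : IsLocated σ.D σ.C z i g)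
    (hc : ¬ IsCut (σ.F m) (σ.D i) g) (hf : f ∈ σ.F m) :
    f * g ∈ σ.D i ∧ (f * g)⁻¹ • f • z ∈ σ.C i := by
  refine ⟨by_contra fun h => hc ⟨hz.1, f, hf, h⟩, ?_⟩
  rw [smul_smul, mul_inv_rev, inv_mul_cancel_right]
  exact hz.2.1

theorem isOpen_not_mem_towersBelow [ContinuousConstSMul G Z] (N : ℕ) (h : G) :
    IsOpen {x : Z × (G → MarkedPoint G Y) | h • x.1 ∉ σ.towersBelow N} :=
  (σ.isClopen_towersBelow N).compl.isOpen.preimage (continuous_fst.const_smul h)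

variable (σ)

/-- The number of marks of level `m` in the slot `l`. -/
def markCount (m l : ℕ) (a : MarkedPoint G Y) : ℕ :=
  ∑ k ∈ σ.B m, if a.2 (m, l, k) = true then 1 else 0

variable {σ}

theorem continuous_markCount (m l : ℕ) : Continuous (σ.markCount m l) :=
  continuous_finsetSum _ fun k _ => continuous_bit (m, l, k)

theorem isClopen_markCount_eq_zero (m l : ℕ) (h : G) :
    IsClopen {x : Z × (G → MarkedPoint G Y) | σ.markCount m l (x.2 h) = 0} :=
  (isClopen_discrete {0}).preimage
    ((continuous_markCount m l).comp ((continuous_apply h).comp continuous_snd))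

end Marks

section Regular

variable {G Z Y : Type*} [Group G] [MulAction G Z] [MetricSpace Z] [MeasurableSpace Z]
  [TopologicalSpace Y] [MulAction G Y] {π : Y → Z} {ν : Measure Z} {σ : ReplacementScheme G π ν}

theorem code_snd_eq_true {y : Y} {z : Z} {m l : ℕ} {k : G}
    (h : (σ.code ⊤ y z).2 (m, l, k) = true) :
    l < σ.L m ∧ IsMarked σ.F σ.D σ.C σ.δ m z l k := by
  by_cases hz : z ∈ σ.towers
  · obtain ⟨i, g, hz⟩ := hz
    rw [code_of_isLocated (by simp) hz, label_snd_eq_true] at h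
    exact ⟨h.2.1, i, g, h.1, hz, h.2.2.1, h.2.2.2⟩
  · simp [code_of_not_mem hz] at h

variable (σ) in
theorem continuous_val : Continuous fun x : σ.Space => x.1 := continuous_subtype_val

open Classical in
theorem markCount_label {m l i : ℕ} {g : G} (hl : l < σ.L m) :
    σ.markCount m l (σ.label i g) = if m ≤ i ∧ IsCut (σ.F m) (σ.D i) g then 1 else 0 := by
  simp only [markCount, label_snd_eq_true]
  split_ifs with h
  · rw [Finset.sum_eq_single (σ.δ m i g l)]
    · simp [h, hl]
    · intro k _ hk
      rw [if_neg]
      exact fun h' => hk h'.2.2.2.symm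
    · exact fun h' => absurd (σ.δ_mem m i g l hl) h'
  · refine Finset.sum_eq_zero fun k _ => if_neg ?_
    exact fun h' => h ⟨h'.1, h'.2.2.1⟩

theorem markCount_label_eq_zero {m i : ℕ} {g : G} (h : σ.markCount m 0 (σ.label i g) = 0)
    (hi : m ≤ i) : ¬ IsCut (σ.F m) (σ.D i) g := by
  intro hc
  rw [markCount_label (σ.L_pos m), if_pos ⟨hi, hc⟩] at h
  exact one_ne_zero h

theorem markCount_eq (x : σ.Space) {m l : ℕ} (hl : l < σ.L m) :
    σ.markCount m l (x.1.2 1) = σ.markCount m 0 (x.1.2 1) := by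
  refine Space.induction (σ := σ)
    (P := fun x => σ.markCount m l (x.2 1) = σ.markCount m 0 (x.2 1)) ?_ ?_ x
  · exact isClosed_eq ((continuous_markCount m l).comp ((continuous_apply 1).comp continuous_snd))
      ((continuous_markCount m 0).comp ((continuous_apply 1).comp continuous_snd))
  · intro y hy
    obtain ⟨i, g, h⟩ := hy 1
    change σ.markCount m l (σ.code ⊤ _ _) = σ.markCount m 0 (σ.code ⊤ _ _)
    rw [code_of_isLocated (by simp) h, markCount_label hl, markCount_label (σ.L_pos m)]

/-- A bound on finitely many marks is a closed condition, so `card_le` passes from the core to X;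
this is why marks are part of the content. -/
theorem sum_marks_le (x : σ.Space) (m : ℕ) :
    (m + 1) * ∑ p ∈ σ.B m ×ˢ Finset.range (σ.L m),
      (if (x.1.2 p.1⁻¹).2 (m, p.2, p.1) = true then 1 else 0) ≤ σ.L m := by
  refine Space.induction (σ := σ) (P := fun x => (m + 1) * ∑ p ∈ σ.B m ×ˢ Finset.range (σ.L m),
      (if (x.2 p.1⁻¹).2 (m, p.2, p.1) = true then 1 else 0) ≤ σ.L m) ?_ ?_ x
  · refine isClosed_le (continuous_const.mul (continuous_finsetSum _ fun p _ => ?_))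
      continuous_const
    exact (continuous_bit (m, p.2, p.1)).comp ((continuous_apply p.1⁻¹).comp continuous_snd)
  · intro y _
    rw [Finset.sum_boole]
    refine σ.card_le m (π y) _ fun p hp => ?_
    exact code_snd_eq_true (Finset.mem_filter.1 hp).2

variable [ContinuousConstSMul G Z]

/-- Unmarked places have contents which are related by the action. -/
theorem fst_mul_eq_smul [T2Space Y] [ContinuousConstSMul G Y] (x : σ.Space) {m : ℕ} {f h : G}
    (hf : f ∈ σ.F m) (hf' : f⁻¹ ∈ σ.F m) (h1 : σ.markCount m 0 (x.1.2 h) = 0)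
    (h2 : σ.markCount m 0 (x.1.2 (f * h)) = 0) (h3 : h • σ.toBase x ∉ σ.towersBelow m)
    (h4 : (f * h) • σ.toBase x ∉ σ.towersBelow m) :
    (x.1.2 (f * h)).1 = f • (x.1.2 h).1 := by
  refine Space.induction (σ := σ) (P := fun x => σ.markCount m 0 (x.2 h) = 0 →
    σ.markCount m 0 (x.2 (f * h)) = 0 → h • x.1 ∉ σ.towersBelow m →
    (f * h) • x.1 ∉ σ.towersBelow m → (x.2 (f * h)).1 = f • (x.2 h).1) ?_ ?_ x h1 h2 h3 h4
  · refine isClosed_imp (isClopen_markCount_eq_zero m 0 h).isOpen <|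
      isClosed_imp (isClopen_markCount_eq_zero m 0 (f * h)).isOpen <|
      isClosed_imp (isOpen_not_mem_towersBelow m h) <|
      isClosed_imp (isOpen_not_mem_towersBelow m (f * h)) <| isClosed_eq ?_ ?_
    · exact continuous_fst.comp ((continuous_apply (f * h)).comp continuous_snd)
    · exact (continuous_fst.comp ((continuous_apply h).comp continuous_snd)).const_smul f
  · intro y hy h1 h2 h3 h4
    obtain ⟨i, g, hi⟩ := hy h
    obtain ⟨j, k, hj⟩ := hy (f * h)
    change σ.markCount m 0 (σ.code ⊤ _ _) = 0 at h1 h2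
    change (σ.code ⊤ _ _).1 = f • (σ.code ⊤ _ _).1
    rw [code_of_isLocated (by simp) hi] at h1 ⊢
    rw [code_of_isLocated (by simp) hj] at h2 ⊢
    have hc1 := markCount_label_eq_zero h1 (σ.le_of_not_mem_towersBelow h3 hi)
    have hc2 := markCount_label_eq_zero h2 (σ.le_of_not_mem_towersBelow h4 hj)
    obtain ⟨e1, e2⟩ := isLocated_smul hi hc1 hf
    obtain ⟨e3, e4⟩ := isLocated_smul hj hc2 hf'
    rw [smul_smul f] at e2
    rw [smul_smul f⁻¹, inv_mul_cancel_left] at e4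
    -- Each of the two places lies in the tower of the other; since locations have minimal index,
    -- the towers agree.
    obtain rfl : i = j := le_antisymm (le_of_isLocated hi e3 e4) (le_of_isLocated hj e1 e2)
    obtain rfl := σ.disjoint i _ e1 k hj.1 _ e2 hj.2.1
    simp [label, mul_smul]

/-- As `F` increases, a cut of level `m` is a cut of every higher level up to the index of its
tower. -/
theorem markCount_ne_zero_of_bit (x : σ.Space) {m l N : ℕ} {k h : G} (hN : m ≤ N)
    (h1 : (x.1.2 h).2 (m, l, k) = true) (h2 : h • σ.toBase x ∉ σ.towersBelow N) :
    σ.markCount N 0 (x.1.2 h) ≠ 0 := by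
  refine Space.induction (σ := σ) (P := fun x => (x.2 h).2 (m, l, k) = true →
    h • x.1 ∉ σ.towersBelow N → ¬ σ.markCount N 0 (x.2 h) = 0) ?_ ?_ x h1 h2
  · refine isClosed_imp ?_ <| isClosed_imp (isOpen_not_mem_towersBelow N h) ?_
    · exact (isClopen_bit h (m, l, k)).isOpen
    · exact (isClopen_markCount_eq_zero N 0 h).compl.isClosed
  · intro y hy h1 h2 h3
    obtain ⟨i, g, hi⟩ := hy h
    change (σ.code ⊤ _ _).2 _ = true at h1
    change σ.markCount N 0 (σ.code ⊤ _ _) = 0 at h3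
    rw [code_of_isLocated (by simp) hi] at h1 h3
    obtain ⟨hg, f, hf, hfg⟩ := (label_snd_eq_true.1 h1).2.2.1
    exact markCount_label_eq_zero h3 (σ.le_of_not_mem_towersBelow h2 hi)
      ⟨hg, f, σ.F_mono hN hf, hfg⟩

theorem dist_le_of_not_mem_towersBelow (hπ : IsEquivariant G π) (hπc : Continuous π)
    (x : σ.Space) {N : ℕ} {h : G} (h1 : h • σ.toBase x ∉ σ.towersBelow N) :
    dist (h • σ.toBase x) (π (x.1.2 h).1) ≤ 1 / (N + 1) := by
  refine Space.induction (σ := σ) (P := fun x => h • x.1 ∉ σ.towersBelow N →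
    dist (h • x.1) (π (x.2 h).1) ≤ 1 / (N + 1)) ?_ ?_ x h1
  · refine isClosed_imp (isOpen_not_mem_towersBelow N h) (isClosed_le ?_ continuous_const)
    exact (continuous_fst.const_smul h).dist
      (hπc.comp (continuous_fst.comp ((continuous_apply h).comp continuous_snd)))
  · intro y hy h1
    obtain ⟨i, g, hi⟩ := hy h
    change dist (h • π y) (π (σ.code ⊤ _ _).1) ≤ _
    rw [code_of_isLocated (by simp) hi]
    have := σ.dist_lt i g hi.1 _ hi.2.1
    rw [smul_inv_smul, ← hπ g] at this
    refine this.le.trans (one_div_le_one_div_of_le (Nat.cast_add_one_pos N) ?_)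
    have := σ.le_of_not_mem_towersBelow h1 hi
    exact_mod_cast Nat.succ_le_succ this

/-- Any two places are simultaneously unmarked at infinitely many levels. -/
def IsRegular (x : σ.Space) : Prop :=
  ∀ h h' : G, ∀ m₀, ∃ m ≥ m₀, σ.markCount m 0 (x.1.2 h) = 0 ∧ σ.markCount m 0 (x.1.2 h') = 0

/-- A place `h` outside the towers has content exactly over its base point, because the errors `1 /
(N + 1)` tend to 0. This content determines `y`. Regularity makes the contents at all other such
places the corresponding translates and excludes marks there; inside towers the labels are forced.
-/
theorem IsRegular.exists_array_eq [T2Space Y] [ContinuousConstSMul G Y] (hπ : IsEquivariant G π)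
    (hπc : Continuous π) {x : σ.Space} (hx : IsRegular x) (hc : σ.toBase x ∉ σ.core) :
    ∃ y, π y ∉ σ.core ∧ σ.array ⊤ y = x.1 := by
  obtain ⟨h, hh⟩ := not_forall.1 hc
  have hdist : π (x.1.2 h).1 = h • σ.toBase x := by
    refine (eq_of_forall_dist_le fun ε hε => ?_).symm
    obtain ⟨N, hN⟩ := exists_nat_one_div_lt hε
    exact (dist_le_of_not_mem_towersBelow hπ hπc x
      fun h' => hh (σ.towersBelow_subset N h')).trans hN.le
  have hy : π (h⁻¹ • (x.1.2 h).1) = σ.toBase x := by rw [hπ, hdist, inv_smul_smul]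
  refine ⟨h⁻¹ • (x.1.2 h).1, hy ▸ hc, Prod.ext hy (funext fun k => ?_)⟩
  change σ.code ⊤ _ _ = _
  rw [hy]
  by_cases hk : k • σ.toBase x ∈ σ.towers
  · obtain ⟨i, g, hi⟩ := hk
    rw [code_of_isLocated (by simp) hi, eq_label_of_isLocated x hi]
  · rw [code_of_not_mem hk]
    refine Prod.ext ?_ (funext fun p => ?_)
    · obtain ⟨m₁, hm₁⟩ := σ.exists_mem_F (k * h⁻¹)
      obtain ⟨m₂, hm₂⟩ := σ.exists_mem_F (k * h⁻¹)⁻¹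
      obtain ⟨m, hm, h1, h2⟩ := hx h k (max m₁ m₂)
      have := fst_mul_eq_smul x (h := h) (σ.F_mono ((le_max_left _ _).trans hm) hm₁)
        (σ.F_mono ((le_max_right _ _).trans hm) hm₂) h1 (by simpa using h2)
        (fun h' => hh (σ.towersBelow_subset m h'))
        (fun h' => hk (by simpa using σ.towersBelow_subset m h'))
      rw [inv_mul_cancel_right, mul_smul] at this
      exact this.symm
    · obtain ⟨m, l, g⟩ := p
      refine (Bool.eq_false_iff.2 fun hp => ?_).symm
      obtain ⟨N, hN, h1, -⟩ := hx k k m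
      exact markCount_ne_zero_of_bit x hN hp (fun h' => hk (σ.towersBelow_subset N h')) h1

end Regular

/-! ### Mass transport -/

section Ergodic

variable {G Z Y : Type*} [Group G] [MulAction G Z] [MetricSpace Z] [MeasurableSpace Z]
  [TopologicalSpace Y] [MulAction G Y] {π : Y → Z} {ν : Measure Z} {σ : ReplacementScheme G π ν}
  [ContinuousConstSMul G Z] {hπ : IsEquivariant G π} {μ : Measure σ.Space}

/-- If slot 0 is occupied, so are all `L m` slots. By invariance a mark of displacement `k` is as
likely at place `1` as at `k⁻¹`, so `L m` times the probability of being marked is at most the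
expected number of marks received, which is at most `L m / (m + 1)`. -/
theorem measure_markCount_ne_zero_le [IsProbabilityMeasure μ]
    (hμ : let _ := σ.mulAction hπ; SMulInvariantMeasure G σ.Space μ) (m : ℕ) :
    (m + 1) * μ {x | σ.markCount m 0 (x.1.2 1) ≠ 0} ≤ 1 := by
  let _ := σ.mulAction hπ
  have hcont : ∀ (h : G) (p : ℕ × ℕ × G), MeasurableSet {x : σ.Space | (x.1.2 h).2 p = true} :=
    fun h p => ((isClopen_bit h p).isOpen.preimage σ.continuous_val).measurableSet
  have h1 : ∀ l < σ.L m, μ {x | σ.markCount m 0 (x.1.2 1) ≠ 0} ≤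
      ∑ k ∈ σ.B m, μ {x : σ.Space | (x.1.2 k⁻¹).2 (m, l, k) = true} := by
    intro l hl
    calc μ {x | σ.markCount m 0 (x.1.2 1) ≠ 0}
        ≤ μ (⋃ k ∈ σ.B m, {x : σ.Space | (x.1.2 1).2 (m, l, k) = true}) := by
          refine measure_mono fun x hx => ?_
          have hx : σ.markCount m 0 (x.1.2 1) ≠ 0 := hx
          rw [← markCount_eq x hl] at hx
          obtain ⟨k, hk, hk'⟩ := Finset.exists_ne_zero_of_sum_ne_zero hx
          exact Set.mem_biUnion hk (by_contra fun h => hk' (if_neg h))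
      _ ≤ ∑ k ∈ σ.B m, μ {x : σ.Space | (x.1.2 1).2 (m, l, k) = true} :=
          measure_biUnion_finset_le _ _
      _ = _ := by
          refine Finset.sum_congr rfl fun k _ => ?_
          rw [← hμ.measure_preimage_smul k⁻¹ (hcont 1 (m, l, k))]
          congr 1
          ext x
          change (x.1.2 (1 * k⁻¹)).2 _ = true ↔ (x.1.2 k⁻¹).2 _ = true
          rw [one_mul]
  have h2 : (σ.L m : ENNReal) * μ {x | σ.markCount m 0 (x.1.2 1) ≠ 0} ≤
      ∑ p ∈ σ.B m ×ˢ Finset.range (σ.L m),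
        μ {x : σ.Space | (x.1.2 p.1⁻¹).2 (m, p.2, p.1) = true} := by
    rw [Finset.sum_product_right, ← nsmul_eq_mul, ← Finset.card_range (σ.L m), ← Finset.sum_const,
      Finset.card_range]
    exact Finset.sum_le_sum fun l hl => h1 l (Finset.mem_range.1 hl)
  have h3 : ∑ p ∈ σ.B m ×ˢ Finset.range (σ.L m),
        μ {x : σ.Space | (x.1.2 p.1⁻¹).2 (m, p.2, p.1) = true} =
      ∫⁻ x, ((∑ p ∈ σ.B m ×ˢ Finset.range (σ.L m),
        (if (x.1.2 p.1⁻¹).2 (m, p.2, p.1) = true then 1 else 0) : ℕ) : ENNReal) ∂μ := by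
    simp only [Nat.cast_sum]
    rw [lintegral_finsetSum]
    · refine Finset.sum_congr rfl fun p _ => ?_
      rw [← lintegral_indicator_one (hcont _ _)]
      refine lintegral_congr fun x => ?_
      by_cases h : (x.1.2 p.1⁻¹).2 (m, p.2, p.1) = true <;> simp [h]
    · intro p _
      have : (fun x : σ.Space => (((if (x.1.2 p.1⁻¹).2 (m, p.2, p.1) = true then 1 else 0 : ℕ)) :
          ENNReal)) = {x : σ.Space | (x.1.2 p.1⁻¹).2 (m, p.2, p.1) = true}.indicator 1 := by
        ext x
        by_cases h : (x.1.2 p.1⁻¹).2 (m, p.2, p.1) = true <;> simp [h]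
      rw [this]
      exact measurable_one.indicator (hcont _ _)
  have h4 : (m + 1 : ENNReal) * ∫⁻ x, ((∑ p ∈ σ.B m ×ˢ Finset.range (σ.L m),
        (if (x.1.2 p.1⁻¹).2 (m, p.2, p.1) = true then 1 else 0) : ℕ) : ENNReal) ∂μ ≤ σ.L m := by
    rw [← lintegral_const_mul' _ _ (by finiteness)]
    calc _ ≤ ∫⁻ _, (σ.L m : ENNReal) ∂μ := lintegral_mono fun x => by
            have := Nat.cast_le (α := ENNReal).2 (sum_marks_le x m)
            rwa [Nat.cast_mul, Nat.cast_add, Nat.cast_one] at this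
      _ = σ.L m := by simp
  have hL : (σ.L m : ENNReal) ≠ 0 := by exact_mod_cast (σ.L_pos m).ne'
  rw [← ENNReal.mul_le_mul_iff_right hL (by finiteness), mul_one, mul_left_comm]
  exact (mul_le_mul_right (h2.trans_eq h3) _).trans h4

/-- A union bound over the two places gives `2 / (m + 1)`, which tends to 0. -/
theorem ae_isRegular [Countable G] [IsProbabilityMeasure μ]
    (hμ : let _ := σ.mulAction hπ; SMulInvariantMeasure G σ.Space μ) :
    ∀ᵐ x ∂μ, IsRegular x := by
  let _ := σ.mulAction hπ
  refine ae_all_iff.2 fun h => ae_all_iff.2 fun h' => ae_all_iff.2 fun m₀ => ?_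
  have hms : ∀ (m : ℕ), MeasurableSet {x : σ.Space | σ.markCount m 0 (x.1.2 1) ≠ 0} := fun m =>
    ((isClopen_markCount_eq_zero m 0 1).compl.isOpen.preimage σ.continuous_val).measurableSet
  have hle : ∀ m ≥ m₀, μ {x : σ.Space | ¬ ∃ m ≥ m₀, σ.markCount m 0 (x.1.2 h) = 0 ∧
      σ.markCount m 0 (x.1.2 h') = 0} ≤ 2 * ((m : ENNReal) + 1)⁻¹ := by
    intro m hm
    have hone : ∀ h : G, μ {x : σ.Space | σ.markCount m 0 (x.1.2 h) ≠ 0} ≤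
        ((m : ENNReal) + 1)⁻¹ := by
      intro h
      have := hμ.measure_preimage_smul h (hms m)
      rw [ENNReal.le_inv_iff_mul_le, mul_comm]
      refine le_trans (le_of_eq ?_) (measure_markCount_ne_zero_le hμ m)
      rw [← this]
      congr 2
      ext x
      change _ ↔ σ.markCount m 0 (x.1.2 (1 * h)) ≠ 0
      rw [one_mul]; rfl
    rw [two_mul]
    refine le_trans (measure_mono fun x hx => ?_) ((measure_union_le _ _).trans
      (add_le_add (hone h) (hone h')))
    by_contra hcon
    simp only [Set.mem_union, Set.mem_ofPred_eq, not_or, not_not] at hcon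
    exact hx ⟨m, hm, hcon⟩
  have hlim : Filter.Tendsto (fun m : ℕ => 2 * ((m : ENNReal) + 1)⁻¹) Filter.atTop (𝓝 0) := by
    have := ENNReal.tendsto_inv_nat_nhds_zero.comp (Filter.tendsto_add_atTop_nat 1)
    have := ENNReal.Tendsto.const_mul (a := 2) this (Or.inr (by simp))
    simpa [Function.comp_def] using this
  exact le_antisymm (ge_of_tendsto hlim (Filter.eventually_atTop.2 ⟨m₀, hle⟩)) bot_le

end Ergodic

end ReplacementScheme

/-! ### Transport of invariant measures -/

section PushForward

variable {G X Y : Type*} [Group G] [MulAction G X] [MulAction G Y] [MeasurableSpace X]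
  [MeasurableSpace Y] [MeasurableConstSMul G X] {ψ : Y → X}

/-- The image of an invariant probability measure under an equivariant map. -/
noncomputable def InvProbMeasure.map (hψ : Measurable ψ) (he : IsEquivariant G ψ)
    (μ : InvProbMeasure G Y) : InvProbMeasure G X :=
  ⟨μ.1.map hψ.aemeasurable, ⟨fun g s hs => by
    rw [ProbabilityMeasure.toMeasure_map, Measure.map_apply hψ hs,
      Measure.map_apply hψ (hs.preimage (measurable_const_smul g)),
      ← μ.2.measure_preimage_smul g (hs.preimage hψ)]
    congr 1
    ext y
    simp [he g y]⟩⟩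

theorem InvProbMeasure.meas_map (hψ : Measurable ψ) (he : IsEquivariant G ψ)
    (μ : InvProbMeasure G Y) : (μ.map hψ he).meas = μ.meas.map ψ :=
  ProbabilityMeasure.toMeasure_map _ hψ.aemeasurable

theorem InvProbMeasure.map_apply (hψ : Measurable ψ) (he : IsEquivariant G ψ)
    (μ : InvProbMeasure G Y) {A : Set X} (hA : MeasurableSet A) :
    (μ.map hψ he).meas A = μ.meas (ψ ⁻¹' A) := by
  rw [meas_map, Measure.map_apply hψ hA]

theorem InvProbMeasure.isAffineOnMeasures_map (hψ : Measurable ψ) (he : IsEquivariant G ψ) :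
    IsAffineOnMeasures (G := G) (InvProbMeasure.map hψ he) := by
  intro a b μ₁ μ₂ μ _ h
  rw [meas_map, meas_map, meas_map, h]
  ext s hs
  simp [Measure.map_apply hψ hs]

/-- An equivariant Borel map which is injective on an invariant Borel set of full measure whose
image has full measure induces a bijection of invariant measures. -/
theorem InvProbMeasure.bijective_map [MeasurableConstSMul G Y] [StandardBorelSpace Y]
    [MeasurableSpace.CountablySeparated X]
    (hψ : Measurable ψ) (he : IsEquivariant G ψ) {W : Set Y} (hW : MeasurableSet W)
    (hinv : ∀ (g : G) {y : Y}, y ∈ W → g • y ∈ W) (hinj : Set.InjOn ψ W)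
    (hY : ∀ μ : InvProbMeasure G Y, μ.meas Wᶜ = 0)
    (hX : ∀ μ : InvProbMeasure G X, ∀ᵐ x ∂μ.meas, x ∈ ψ '' W) :
    Function.Bijective (InvProbMeasure.map (G := G) hψ he) := by
  have hst : StandardBorelSpace W := hW.standardBorel
  let e : W → X := fun w => ψ w
  -- Lusin–Souslin: injective Borel images of Borel sets of `W` are Borel.
  have hemb : MeasurableEmbedding e :=
    (hψ.comp measurable_subtype_coe).measurableEmbedding (Set.injOn_iff_injective.1 hinj)
  have hrange : Set.range e = ψ '' W := by
    ext x; simp [e]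
  have himg : ∀ A : Set Y, e '' (Subtype.val ⁻¹' A) = ψ '' (A ∩ W) := by
    intro A; ext x
    constructor
    · rintro ⟨w, hw, rfl⟩
      exact ⟨w, ⟨hw, w.2⟩, rfl⟩
    · rintro ⟨y, ⟨hyA, hyW⟩, rfl⟩
      exact ⟨⟨y, hyW⟩, hyA, rfl⟩
  have hmimg : ∀ A : Set Y, MeasurableSet A → MeasurableSet (ψ '' (A ∩ W)) := by
    intro A hA
    rw [← himg]
    exact hemb.measurableSet_image.2 (hA.preimage measurable_subtype_coe)
  constructor
  · intro μ₁ μ₂ h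
    have key : ∀ (μ : InvProbMeasure G Y) (A : Set Y), MeasurableSet A →
        μ.meas A = (μ.map hψ he).meas (ψ '' (A ∩ W)) := by
      intro μ A hA
      rw [map_apply hψ he μ (hmimg A hA)]
      refine measure_congr ?_
      have : ∀ᵐ y ∂μ.meas, y ∈ W := hY μ
      filter_upwards [this] with y hy
      refine propext ⟨fun h => ⟨y, ⟨h, hy⟩, rfl⟩, ?_⟩
      rintro ⟨y', ⟨h1, h2⟩, h3⟩
      rwa [hinj h2 hy h3] at h1
    refine Subtype.ext (Subtype.ext (Measure.ext fun A hA => ?_))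
    exact (key μ₁ A hA).trans ((congrArg (fun ρ : InvProbMeasure G X => ρ.meas _) h).trans
      (key μ₂ A hA).symm)
  · intro μ
    -- The preimage measure lives on `W`, where `ψ` is invertible onto a set of full measure.
    let ρ : Measure Y := (μ.meas.comap e).map Subtype.val
    have hρ : ∀ A, MeasurableSet A → ρ A = μ.meas (ψ '' (A ∩ W)) := by
      intro A hA
      rw [Measure.map_apply measurable_subtype_coe hA, hemb.comap_apply, himg]
    have hfull : ∀ A : Set X, μ.meas (A ∩ ψ '' W) = μ.meas A := by
      intro A
      refine measure_congr ?_
      filter_upwards [hX μ] with x hx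
      exact propext ⟨fun h => h.1, fun h => ⟨h, hx⟩⟩
    have hP : IsProbabilityMeasure ρ := ⟨by
      rw [hρ _ MeasurableSet.univ, Set.univ_inter, ← Set.univ_inter (ψ '' W), hfull]
      exact measure_univ⟩
    have hI : SMulInvariantMeasure G Y ρ := ⟨fun g A hA => by
      have hA' : MeasurableSet ((fun y => g • y) ⁻¹' A) :=
        hA.preimage (measurable_const_smul g)
      rw [hρ _ hA, hρ _ hA', ← μ.2.measure_preimage_smul g (hmimg A hA)]
      congr 1
      ext x
      constructor
      · rintro ⟨y, ⟨h1, h2⟩, rfl⟩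
        exact ⟨g • y, ⟨h1, hinv g h2⟩, he g y⟩
      · rintro ⟨y, ⟨h1, h2⟩, h3⟩
        refine ⟨g⁻¹ • y, ⟨by simpa using h1, hinv g⁻¹ h2⟩, ?_⟩
        rw [he, h3]
        exact inv_smul_smul g x⟩
    refine ⟨⟨⟨ρ, hP⟩, hI⟩, Subtype.ext (Subtype.ext (Measure.ext fun A hA => ?_))⟩
    refine (map_apply hψ he _ hA).trans ?_
    change ρ _ = μ.meas A
    rw [hρ _ (hA.preimage hψ), ← hfull A]
    congr 1
    ext x
    constructor
    · rintro ⟨y, ⟨h1, h2⟩, rfl⟩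
      exact ⟨h1, y, h2, rfl⟩
    · rintro ⟨h1, y, h2, rfl⟩
      exact ⟨y, ⟨h1, h2⟩, rfl⟩

end PushForward

/-- Otherwise the normalized restriction to `A` would be a second invariant measure. -/
theorem InvProbMeasure.eq_zero_of_lt_one {G Z : Type*} [Group G] [MulAction G Z]
    [MeasurableSpace Z] [MeasurableConstSMul G Z] (ν : InvProbMeasure G Z) (hν : ∀ ν' : InvProbMeasure G Z, ν' = ν)
    {A : Set Z} (hA : MeasurableSet A) (hinv : ∀ (g : G) (z : Z), g • z ∈ A ↔ z ∈ A)
    (h : ν.meas A < 1) : ν.meas A = 0 := by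
  by_contra h0
  have hP : IsProbabilityMeasure ((ν.meas A)⁻¹ • ν.meas.restrict A) := ⟨by
    rw [Measure.smul_apply, Measure.restrict_apply_univ, smul_eq_mul,
      ENNReal.inv_mul_cancel h0 (by finiteness)]⟩
  have hI : SMulInvariantMeasure G Z ((ν.meas A)⁻¹ • ν.meas.restrict A) := ⟨fun g s hs => by
    rw [Measure.smul_apply, Measure.smul_apply, Measure.restrict_apply hs,
      Measure.restrict_apply (hs.preimage (measurable_const_smul g)),
      ← ν.2.measure_preimage_smul g (hs.inter hA)]
    congr 2
    ext z
    simp [hinv]⟩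
  have := congrArg (fun ρ : InvProbMeasure G Z => ρ.meas A) (hν ⟨⟨_, hP⟩, hI⟩)
  change ((ν.meas A)⁻¹ • ν.meas.restrict A) A = ν.meas A at this
  rw [Measure.smul_apply, Measure.restrict_apply hA, Set.inter_self, smul_eq_mul,
    ENNReal.inv_mul_cancel h0 (by finiteness)] at this
  exact h.ne this.symm

/-- A continuous function on a product is determined up to a small error by finitely many
coordinates. -/
theorem exists_finset_dist_lt_of_eqOn {ι Z A : Type*} [TopologicalSpace Z] [CompactSpace Z]
    [T2Space Z] [TopologicalSpace A] [CompactSpace A] [T2Space A] (f : C(Z × (ι → A), ℝ)) {ε : ℝ}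
    (hε : 0 < ε) : ∃ I : Finset ι, ∀ x y : Z × (ι → A), x.1 = y.1 → (∀ i ∈ I, x.2 i = y.2 i) →
      dist (f x) (f y) < ε := by
  classical
  let V : Finset ι → Set ((Z × (ι → A)) × (Z × (ι → A))) := fun I =>
    {p | p.1.1 = p.2.1 ∧ ∀ i ∈ I, p.1.2 i = p.2.2 i}
  have hV : ∀ I, IsClosed (V I) := by
    intro I
    have : V I = {p | p.1.1 = p.2.1} ∩ ⋂ i ∈ I, {p | p.1.2 i = p.2.2 i} := by
      ext p; simp [V]
    rw [this]
    refine (isClosed_eq (by fun_prop) (by fun_prop)).inter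
      (isClosed_biInter fun i _ => isClosed_eq (by fun_prop) (by fun_prop))
  have hopen : IsOpen {p : (Z × (ι → A)) × (Z × (ι → A)) | dist (f p.1) (f p.2) < ε} :=
    isOpen_lt (by fun_prop) continuous_const
  -- The compact sets `V I` decrease to the diagonal, where the open condition holds.
  obtain ⟨I, hI⟩ := exists_subset_nhds_of_isCompact' (V := V)
    (fun I J => ⟨I ∪ J, fun p hp => ⟨hp.1, fun i hi => hp.2 i (Finset.mem_union_left _ hi)⟩,
      fun p hp => ⟨hp.1, fun i hi => hp.2 i (Finset.mem_union_right _ hi)⟩⟩)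
    (fun I => (hV I).isCompact) hV
    (U := {p : (Z × (ι → A)) × (Z × (ι → A)) | dist (f p.1) (f p.2) < ε}) (by
      rintro ⟨x, y⟩ hp
      rw [Set.mem_iInter] at hp
      have : x = y := Prod.ext (hp ∅).1 (funext fun i => (hp {i}).2 i (by simp))
      subst this
      exact hopen.mem_nhds (by simpa using hε))
  exact ⟨I, fun x y h1 h2 => hI (show (x, y) ∈ V I from ⟨h1, h2⟩)⟩

theorem integral_smul_eq {G Y : Type*} [Group G] [MulAction G Y] [MeasurableSpace Y]
    [MeasurableConstSMul G Y] (μ : Measure Y) [hμ : SMulInvariantMeasure G Y μ] (g : G)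
    (f : Y → ℝ) : ∫ y, f (g • y) ∂μ = ∫ y, f y ∂μ :=
  (measurePreserving_smul g μ).integral_comp (measurableEmbedding_const_smul g) f

theorem isClosed_smulInvariantMeasure (G Y : Type*) [Group G] [MulAction G Y] [MetricSpace Y]
    [MeasurableSpace Y] [BorelSpace Y] [ContinuousConstSMul G Y] :
    IsClosed {μ : ProbabilityMeasure Y | SMulInvariantMeasure G Y (μ : Measure Y)} := by
  have : {μ : ProbabilityMeasure Y | SMulInvariantMeasure G Y (μ : Measure Y)} =
      ⋂ (g : G) (f : BoundedContinuousFunction Y ℝ), {μ : ProbabilityMeasure Y |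
        ∫ y, f.compContinuous ⟨fun y => g • y, continuous_const_smul g⟩ y ∂(μ : Measure Y) =
          ∫ y, f y ∂(μ : Measure Y)} := by
    ext μ
    simp only [Set.mem_iInter, Set.mem_ofPred_eq]
    constructor
    · intro hμ g f
      exact integral_smul_eq _ g f
    · intro h
      exact smulInvariantMeasure_of_integral_eq _ h
  rw [this]
  exact isClosed_iInter fun g => isClosed_iInter fun f => isClosed_eq
    (ProbabilityMeasure.continuous_integral_boundedContinuousFunction _)
    (ProbabilityMeasure.continuous_integral_boundedContinuousFunction _)

/-- Finitely many translates of an isolated point would cover the space. -/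
theorem perfectSpace_of_isMinimal {G X : Type*} [Group G] [MulAction G X] [TopologicalSpace X]
    [CompactSpace X] [ContinuousConstSMul G X] [MulAction.IsMinimal G X] [Infinite X] :
    PerfectSpace X := by
  refine perfectSpace_iff_forall_not_isolated.2 fun x => ?_
  by_contra hx
  have hopen : IsOpen {x} := by
    rw [isOpen_singleton_iff_punctured_nhds]
    exact Filter.not_neBot.1 hx
  obtain ⟨I, hI⟩ := isCompact_univ.exists_finite_cover_smul G hopen ⟨x, rfl⟩
  refine Set.infinite_univ (α := X) (Set.Finite.subset ?_ hI)
  exact I.finite_toSet.biUnion fun g _ => by simp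

theorem infinite_of_perfectSpace (Z : Type*) [TopologicalSpace Z] [T1Space Z] [PerfectSpace Z]
    [Nonempty Z] : Infinite Z := by
  by_contra h
  have := not_infinite_iff_finite.1 h
  obtain ⟨z⟩ := ‹Nonempty Z›
  have hz := perfectSpace_iff_forall_not_isolated.1 ‹PerfectSpace Z› z
  have : IsOpen ({z} : Set Z) := isOpen_discrete _
  rw [isOpen_singleton_iff_punctured_nhds] at this
  exact hz.ne this

namespace ReplacementScheme

/-! ### Continuous approximations of the arrays -/

section Approximation

variable {G Z Y : Type*} [Group G] [MulAction G Z] [MetricSpace Z] [MeasurableSpace Z]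
  [TopologicalSpace Y] [MulAction G Y] {π : Y → Z} {ν : Measure Z} (σ : ReplacementScheme G π ν)

theorem code_eq_of_not_mem {N : ℕ} {y : Y} {z : Z} (h : z ∉ σ.towers \ σ.towersBelow N) :
    σ.code ⊤ y z = σ.code N y z := by
  by_cases hz : z ∈ σ.towersBelow N
  · simp only [towersBelow, Set.mem_iUnion] at hz
    obtain ⟨i, hi, g, hg, hz⟩ := hz
    obtain ⟨j, hj, k, hk⟩ := exists_isLocated_le hg hz
    rw [code_of_isLocated (by simp) hk, code_of_isLocated _ hk]
    exact_mod_cast hj.trans_lt (Finset.mem_range.1 hi)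
  · have hz' : z ∉ σ.towers := fun h' => h ⟨h', hz⟩
    rw [code_of_not_mem hz', code_of_not_mem hz']

theorem tendsto_array (y : Y) :
    Filter.Tendsto (fun N : ℕ => σ.array N y) Filter.atTop (𝓝 (σ.array ⊤ y)) := by
  refine Filter.Tendsto.prodMk_nhds tendsto_const_nhds (tendsto_pi_nhds.2 fun h => ?_)
  refine tendsto_const_nhds.congr' ?_
  by_cases hz : h • π y ∈ σ.towers
  · obtain ⟨i, g, hi⟩ := hz
    filter_upwards [Filter.eventually_gt_atTop i] with N hN
    rw [code_of_isLocated (by simp) hi, code_of_isLocated (by exact_mod_cast hN) hi]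
  · exact Filter.Eventually.of_forall fun N =>
      (code_of_not_mem hz).trans (code_of_not_mem hz).symm

variable [ContinuousConstSMul G Z]

/-- Towers are clopen: the truncated code is locally constant on those below `N` and given by the
action off them. -/
theorem continuous_code [ContinuousConstSMul G Y] (hπ : Continuous π) (N : ℕ) (h : G) :
    Continuous fun y => σ.code N (h • y) (h • π y) := by
  refine continuous_iff_continuousAt.2 fun y => ?_
  by_cases hy : h • π y ∈ σ.towersBelow N
  · simp only [towersBelow, Set.mem_iUnion] at hy
    obtain ⟨i, hi, g, hg, hz⟩ := hy
    obtain ⟨j, hj, k, hk⟩ := exists_isLocated_le hg hz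
    have hjN : (j : ℕ∞) < N := by exact_mod_cast hj.trans_lt (Finset.mem_range.1 hi)
    refine (continuousAt_const (y := σ.label j k)).congr ?_
    filter_upwards [((σ.isClopen_isLocated h j k).isOpen.preimage hπ).mem_nhds hk] with y' hy'
    exact (code_of_isLocated hjN hy').symm
  · have hc : Continuous fun y : Y => ((h • y, fun _ => false) : MarkedPoint G Y) :=
      (continuous_const_smul h).prodMk continuous_const
    refine hc.continuousAt.congr ?_
    have ho : IsOpen {y : Y | h • π y ∉ σ.towersBelow N} :=
      (σ.isClopen_towersBelow N).compl.isOpen.preimage (hπ.const_smul h)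
    filter_upwards [ho.mem_nhds hy] with y' hy'
    refine (code_of_forall_not fun i g hi hl => hy' ?_).symm
    simp only [towersBelow, Set.mem_iUnion]
    exact ⟨i, Finset.mem_range.2 (by exact_mod_cast hi), g, hl.1, hl.2.1⟩

theorem continuous_array [ContinuousConstSMul G Y] (hπ : Continuous π) (N : ℕ) :
    Continuous (σ.array N) :=
  hπ.prodMk (continuous_pi fun h => σ.continuous_code hπ N h)

end Approximation

/-! ### The Borel map ψ and its action on measures -/

section Lift

variable {G Z Y : Type*} [Group G] [Countable G] [MulAction G Z] [MetricSpace Z] [CompactSpace Z]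
  [MeasurableSpace Z] [ContinuousConstSMul G Z] [MetricSpace Y] [MulAction G Y]
  [ContinuousConstSMul G Y] {π : Y → Z} {ν : Measure Z} (σ : ReplacementScheme G π ν)

/-- The Borel map from `Y` to the extension defined by the scheme. -/
noncomputable def lift (hπ : IsFactorMap G π) (y : Y) : σ.Space :=
  ⟨σ.array ⊤ y, σ.array_mem hπ.continuous hπ.surjective y⟩

theorem isEquivariant_lift (hπ : IsFactorMap G π) :
    let _ := σ.mulAction hπ.equivariant
    IsEquivariant G (σ.lift hπ) :=
  fun g y => Subtype.ext (σ.shift_array hπ.equivariant ⊤ g y).symm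

theorem injOn_lift (hπ : IsFactorMap G π) : Set.InjOn (σ.lift hπ) (π ⁻¹' σ.coreᶜ) := by
  intro y hy y' _ h
  have h1 : σ.array ⊤ y = σ.array ⊤ y' := congrArg Subtype.val h
  have h2 : π y = π y' := congrArg Prod.fst h1
  obtain ⟨k, hk⟩ := not_forall.1 hy
  have h3 : σ.code ⊤ (k • y) (k • π y) = σ.code ⊤ (k • y') (k • π y') :=
    congrFun (congrArg Prod.snd h1) k
  rw [code_of_not_mem hk, code_of_not_mem (h2 ▸ hk)] at h3
  exact MulAction.injective k (congrArg Prod.fst h3)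

variable [CompactSpace Y] [MeasurableSpace Y] [BorelSpace Y]

theorem measurable_array (hπ : Continuous π) {o : Set (Z × (G → MarkedPoint G Y))}
    (ho : IsOpen o) : MeasurableSet (σ.array ⊤ ⁻¹' o) := by
  let _ : MeasurableSpace (Z × (G → MarkedPoint G Y)) := borel _
  have : BorelSpace (Z × (G → MarkedPoint G Y)) := ⟨rfl⟩
  have : TopologicalSpace.MetrizableSpace (Z × (G → MarkedPoint G Y)) :=
    TopologicalSpace.metrizableSpace_of_t3_secondCountable _
  have : Measurable (σ.array ⊤) := measurable_of_tendsto_metrizable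
    (fun N => (σ.continuous_array hπ N).measurable)
    (tendsto_pi_nhds.2 fun y => σ.tendsto_array y)
  exact this ho.measurableSet

theorem measurable_lift (hπ : IsFactorMap G π) : Measurable (σ.lift hπ) := by
  refine measurable_of_isOpen ?_
  rintro _ ⟨o, ho, rfl⟩
  exact σ.measurable_array hπ.continuous ho

variable [BorelSpace Z]

/-- Two arrays of `y` differ at a place of `I` only if it lies in towers but in none below `N`. This
has probability at most `2⁻¹ ^ (N + 1)` per place, uniformly in `μ`, since `μ` projects to `ν`. -/
theorem abs_integral_array_sub_le (hπ : Continuous π) (f : C(Z × (G → MarkedPoint G Y), ℝ))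
    {ε : ℝ} {I : Finset G}
    (hI : ∀ x y : Z × (G → MarkedPoint G Y), x.1 = y.1 → (∀ i ∈ I, x.2 i = y.2 i) →
      dist (f x) (f y) < ε) (hν : SMulInvariantMeasure G Z ν) (μ : Measure Y)
    [IsProbabilityMeasure μ] (hμ : μ.map π = ν) (N : ℕ) :
    |∫ y, f (σ.array ⊤ y) ∂μ - ∫ y, f (σ.array N y) ∂μ| ≤
      ε + 2 * ‖f‖ * (I.card * (2⁻¹ : ℝ) ^ (N + 1)) := by
  have hmeas : MeasurableSet (σ.towers \ σ.towersBelow N) :=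
    (σ.isOpen_towers.sdiff (σ.isClopen_towersBelow N).isClosed).measurableSet
  let bad : Set Y := ⋃ h ∈ I, (fun y => h • π y) ⁻¹' (σ.towers \ σ.towersBelow N)
  have hbad : MeasurableSet bad := I.measurableSet_biUnion fun h _ =>
    hmeas.preimage (hπ.const_smul h).measurable
  have hμbad : μ.real bad ≤ I.card * (2⁻¹ : ℝ) ^ (N + 1) := by
    have : μ bad ≤ I.card * (2⁻¹ : ENNReal) ^ (N + 1) := by
      refine (measure_biUnion_finset_le _ _).trans ?_
      rw [← nsmul_eq_mul]
      refine Finset.sum_le_card_nsmul _ _ _ fun h _ => ?_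
      refine le_trans (le_of_eq ?_) (σ.measure_towers_diff_le hν N)
      have e := congrArg (fun ρ : Measure Z =>
        ρ ((fun z => h • z) ⁻¹' (σ.towers \ σ.towersBelow N))) hμ
      beta_reduce at e
      rw [Measure.map_apply hπ.measurable (hmeas.preimage (measurable_const_smul h)),
        hν.measure_preimage_smul h hmeas] at e
      exact e
    refine (ENNReal.toReal_mono (by finiteness) this).trans_eq ?_
    simp
  have hpt : ∀ y, |f (σ.array ⊤ y) - f (σ.array N y)| ≤ ε + bad.indicator (fun _ => 2 * ‖f‖) y := by
    intro y
    by_cases hy : y ∈ bad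
    · have hε : 0 < ε := dist_nonneg.trans_lt (hI (σ.array ⊤ y) _ rfl fun _ _ => rfl)
      rw [Set.indicator_of_mem hy]
      have h1 := f.norm_coe_le_norm (σ.array ⊤ y)
      have h2 := f.norm_coe_le_norm (σ.array N y)
      have := norm_sub_le (f (σ.array ⊤ y)) (f (σ.array N y))
      rw [Real.norm_eq_abs] at this
      linarith
    · rw [Set.indicator_of_notMem hy, add_zero]
      exact (hI (σ.array ⊤ y) (σ.array N y) rfl fun h hh =>
        σ.code_eq_of_not_mem fun h' => hy (Set.mem_biUnion hh h')).le
  have hm1 : Measurable fun y => f (σ.array ⊤ y) := measurable_of_isOpen fun o ho =>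
    σ.measurable_array hπ (ho.preimage f.continuous)
  have hm2 : Measurable fun y => f (σ.array N y) :=
    (f.continuous.comp (σ.continuous_array hπ N)).measurable
  have hi1 : Integrable (fun y => f (σ.array ⊤ y)) μ :=
    .of_bound hm1.aestronglyMeasurable ‖f‖ (.of_forall fun y => f.norm_coe_le_norm _)
  have hi2 : Integrable (fun y => f (σ.array N y)) μ :=
    .of_bound hm2.aestronglyMeasurable ‖f‖ (.of_forall fun y => f.norm_coe_le_norm _)
  have hi3 : Integrable (bad.indicator fun _ => 2 * ‖f‖) μ := (integrable_const _).indicator hbad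
  calc |∫ y, f (σ.array ⊤ y) ∂μ - ∫ y, f (σ.array N y) ∂μ|
      = |∫ y, (f (σ.array ⊤ y) - f (σ.array N y)) ∂μ| := by rw [integral_sub hi1 hi2]
    _ ≤ ∫ y, |f (σ.array ⊤ y) - f (σ.array N y)| ∂μ := abs_integral_le_integral_abs
    _ ≤ ∫ y, (ε + bad.indicator (fun _ => 2 * ‖f‖) y) ∂μ :=
        integral_mono (hi1.sub hi2).abs ((integrable_const _).add hi3) hpt
    _ = ε + 2 * ‖f‖ * μ.real bad := by
        rw [integral_add (integrable_const _) hi3, integral_indicator_const _ hbad]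
        simp [mul_comm]
    _ ≤ _ := by gcongr

/-- By Tietze a test function extends to the whole product. Its integrals along `array N` are
continuous in `μ` and approximate those along `array ⊤` uniformly. -/
theorem continuous_map_lift (hπ : IsFactorMap G π) (hν : SMulInvariantMeasure G Z ν)
    (hμν : ∀ μ : InvProbMeasure G Y, μ.meas.map π = ν) :
    Continuous fun μ : InvProbMeasure G Y =>
      μ.1.map (σ.measurable_lift hπ).aemeasurable := by
  rw [continuous_iff_continuousAt]
  intro μ₀
  refine ProbabilityMeasure.tendsto_iff_forall_integral_tendsto.2 fun φ => ?_
  obtain ⟨f, hf⟩ := ContinuousMap.exists_extension (e := fun x : σ.Space => x.1)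
    isClosed_closure.isClosedEmbedding_subtypeVal (φ : C(σ.Space, ℝ))
  have hval : ∀ μ : InvProbMeasure G Y, ∫ x, φ x ∂(μ.1.map (σ.measurable_lift hπ).aemeasurable :
      Measure σ.Space) = ∫ y, f (σ.array ⊤ y) ∂μ.meas := by
    intro μ
    rw [ProbabilityMeasure.toMeasure_map, integral_map (σ.measurable_lift hπ).aemeasurable
      φ.continuous.measurable.aestronglyMeasurable]
    exact integral_congr_ae (.of_forall fun y => (ContinuousMap.congr_fun hf (σ.lift hπ y)).symm)
  simp only [hval]
  refine Continuous.tendsto (f := fun μ : InvProbMeasure G Y => ∫ y, f (σ.array ⊤ y) ∂μ.meas) ?_ μ₀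
  refine continuous_of_uniform_approx_of_continuous fun u hu => ?_
  obtain ⟨ε, hε, hu⟩ := Metric.mem_uniformity_dist.1 hu
  obtain ⟨I, hI⟩ := exists_finset_dist_lt_of_eqOn f (half_pos hε)
  have hlim : Filter.Tendsto (fun N : ℕ => 2 * ‖f‖ * (I.card * (2⁻¹ : ℝ) ^ (N + 1)))
      Filter.atTop (𝓝 0) := by
    have := (tendsto_pow_atTop_nhds_zero_of_lt_one (r := (2⁻¹ : ℝ)) (by norm_num)
      (by norm_num)).comp (Filter.tendsto_add_atTop_nat 1)
    simpa using (this.const_mul (I.card : ℝ)).const_mul (2 * ‖f‖)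
  obtain ⟨N, hN⟩ := (hlim.eventually (gt_mem_nhds (half_pos hε))).exists
  refine ⟨fun μ => ∫ y, f (σ.array N y) ∂μ.meas, ?_, fun μ => hu ?_⟩
  · exact (ProbabilityMeasure.continuous_integral_boundedContinuousFunction
      (BoundedContinuousFunction.mkOfCompact
        (f.comp ⟨_, σ.continuous_array hπ.continuous N⟩))).comp continuous_subtype_val
  · have := σ.abs_integral_array_sub_le hπ.continuous f hI hν μ.meas (hμν μ) N
    rw [Real.dist_eq]
    linarith

end Lift

end ReplacementScheme

/-! ### Proof of the theorem -/

theorem IsFactorMap.dense_stabilizer_eq_bot {G Z Y : Type*} [Group G] [MulAction G Z]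
    [TopologicalSpace Z] [MulAction G Y] [TopologicalSpace Y] {π : Y → Z} (hπ : IsFactorMap G π)
    (hY : MulAction.IsMinimal G Y) (hZ : HasFreeOrbit G Z) :
    Dense {y : Y | MulAction.stabilizer G (π y) = ⊥} := by
  obtain ⟨z, hz⟩ := hZ
  obtain ⟨y, rfl⟩ := hπ.surjective z
  refine (hY.dense_orbit y).mono ?_
  rintro _ ⟨g, rfl⟩
  change MulAction.stabilizer G (π (g • y)) = ⊥
  rw [hπ.equivariant, eq_bot_iff]
  intro h hh
  have h1 : g⁻¹ * h * g ∈ MulAction.stabilizer G (π y) := by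
    rw [MulAction.mem_stabilizer_iff] at hh ⊢
    rw [mul_smul, mul_smul, hh, inv_smul_smul]
  rw [hz, Subgroup.mem_bot] at h1
  rw [Subgroup.mem_bot]
  have h2 : h = g * (g⁻¹ * h * g) * g⁻¹ := by group
  rw [h2, h1, mul_one, mul_inv_cancel]

theorem theorem1 (G : Type u) [Group G] [Countable G] [Infinite G] [Group.ResiduallyFinite G]
    -- the system `(Z, G)`
    (Z : Type v) [MetricSpace Z] [CompactSpace Z] [MeasurableSpace Z] [BorelSpace Z]
    [MulAction G Z] [ContinuousConstSMul G Z]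
    (hZ_minimal : MulAction.IsMinimal G Z) (hZ_equicontinuous : IsEquicontinuousAction G Z)
    (hZ_free : HasFreeOrbit G Z) (hZ_cantor : IsCantorSet Z)
    -- its extension `(Y, G)`
    (Y : Type w) [MetricSpace Y] [CompactSpace Y] [MeasurableSpace Y] [BorelSpace Y]
    [MulAction G Y] [ContinuousConstSMul G Y]
    (hY_minimal : MulAction.IsMinimal G Y) (π : Y → Z) (hπ : IsFactorMap G π) :
    -- the unique invariant probability measure of `(Z, G)`
    ∃ ν : InvProbMeasure G Z, (∀ ν' : InvProbMeasure G Z, ν' = ν) ∧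
      ∃ (X : Type (max u v w)) (_ : MetricSpace X) (_ : CompactSpace X)
        (_ : MeasurableSpace X) (_ : BorelSpace X)
        (_ : MulAction G X) (_ : ContinuousConstSMul G X) (τ : X → Z) (ψ : Y → X),
        MulAction.IsMinimal G X ∧ IsAlmostOneToOneFactorMap G τ ∧
        Measurable ψ ∧ IsEquivariant G ψ ∧
        τ ∘ ψ = π ∧
        (∃ Z' : Set Z, MeasurableSet Z' ∧ ν.meas Z'ᶜ = 0 ∧ Set.InjOn ψ (π ⁻¹' Z')) ∧
        ∃ Ψ : InvProbMeasure G Y → InvProbMeasure G X,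
          (∀ (μ : InvProbMeasure G Y) (A : Set X), MeasurableSet A →
            (Ψ μ).meas A = μ.meas (ψ ⁻¹' A)) ∧
          IsAffineOnMeasures Ψ ∧ Function.Bijective Ψ ∧
          (IsCantorSet Y → IsCantorSet X ∧ IsHomeomorph Ψ) := by
  obtain ⟨hZne, -, -, hZtd, hZp⟩ := hZ_cantor
  obtain ⟨ν, hν⟩ := existsUnique_invProbMeasure (G := G) (Z := Z) hZ_equicontinuous
  have : Nonempty Y := hπ.surjective.nonempty
  obtain ⟨σ⟩ := nonempty_replacementScheme (G := G) hπ.continuous ν.meas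
    (hπ.dense_stabilizer_eq_bot hY_minimal hZ_free)
    (fun z hz => measure_singleton_eq_zero_of_stabilizer_eq_bot ν.meas ν.2 hz)
  have hcore : ν.meas σ.core = 0 := by
    refine InvProbMeasure.eq_zero_of_lt_one ν hν σ.measurableSet_core
      (fun g z => ReplacementScheme.smul_mem_core_iff g) ?_
    calc ν.meas σ.core ≤ ν.meas (σ.towers \ σ.towersBelow 0) :=
          measure_mono fun z hz => ⟨by simpa using hz 1, by simp [ReplacementScheme.towersBelow]⟩
      _ ≤ (2⁻¹ : ENNReal) ^ (0 + 1) := σ.measure_towers_diff_le ν.2 0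
      _ < 1 := by simp
  let aX : MulAction G σ.Space := σ.mulAction hπ.equivariant
  have cX : ContinuousConstSMul G σ.Space := σ.continuousConstSMul hπ.equivariant
  have hX_minimal : MulAction.IsMinimal G σ.Space := ReplacementScheme.isMinimal hZ_minimal hπ.equivariant
  have hτ : IsAlmostOneToOneFactorMap G σ.toBase := ReplacementScheme.isAlmostOneToOneFactorMap hπ
  have hmX : TopologicalSpace.MetrizableSpace σ.Space :=
    TopologicalSpace.metrizableSpace_of_t3_secondCountable _
  let mX : MetricSpace σ.Space := TopologicalSpace.metrizableSpaceMetric σ.Space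
  have hψ := σ.measurable_lift hπ
  have he : IsEquivariant G (σ.lift hπ) := σ.isEquivariant_lift hπ
  have hmap : ∀ μ : InvProbMeasure G Y, μ.meas.map π = ν.meas := fun μ =>
    (μ.meas_map hπ.continuous.measurable hπ.equivariant).symm.trans
      (congrArg InvProbMeasure.meas (hν _))
  have hbij : Function.Bijective (InvProbMeasure.map (G := G) hψ he) := by
    refine InvProbMeasure.bijective_map hψ he (W := π ⁻¹' σ.coreᶜ)
      (hπ.continuous.measurable σ.measurableSet_core.compl) ?_ (σ.injOn_lift hπ) ?_ ?_
    · intro g y hy hgy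
      rw [hπ.equivariant] at hgy
      exact hy ((ReplacementScheme.smul_mem_core_iff g).1 hgy)
    · intro μ
      rw [← Set.preimage_compl, compl_compl,
        ← Measure.map_apply hπ.continuous.measurable σ.measurableSet_core, hmap, hcore]
    -- Each invariant measure on X projects to `ν`, so almost every point is off the core and
    -- regular, hence in the image of ψ.
    · intro μ
      have h1 : ∀ᵐ x ∂μ.meas, σ.toBase x ∉ σ.core := by
        have h2 := InvProbMeasure.map_apply σ.continuous_toBase.measurable hτ.equivariant μ
          σ.measurableSet_core
        rw [hν (μ.map _ _), hcore] at h2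
        have h3 : σ.toBase ⁻¹' σ.coreᶜ ∈ ae μ.meas := by
          rw [mem_ae_iff, ← Set.preimage_compl, compl_compl]
          exact h2.symm
        exact h3
      filter_upwards [h1, ReplacementScheme.ae_isRegular μ.2] with x hx hr
      obtain ⟨y, hy, hyx⟩ := hr.exists_array_eq hπ.equivariant hπ.continuous hx
      exact ⟨y, hy, Subtype.ext hyx⟩
  refine ⟨ν, hν, σ.Space, mX, inferInstance, inferInstance, inferInstance, aX, cX, σ.toBase,
    σ.lift hπ, hX_minimal, hτ, hψ, he, rfl, ⟨σ.coreᶜ, σ.measurableSet_core.compl, ?_,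
      σ.injOn_lift hπ⟩, InvProbMeasure.map hψ he, fun μ A hA => μ.map_apply hψ he hA,
    InvProbMeasure.isAffineOnMeasures_map hψ he, hbij, fun hY => ?_⟩
  · rw [compl_compl, hcore]
  · have : TotallyDisconnectedSpace Y := hY.2.2.2.1
    have : Infinite Z := infinite_of_perfectSpace Z
    have : Infinite σ.Space := Infinite.of_surjective _ hτ.surjective
    refine ⟨⟨inferInstance, inferInstance, hmX, inferInstance,
      perfectSpace_of_isMinimal (G := G)⟩, ?_⟩
    have : CompactSpace (InvProbMeasure G Y) :=
      isCompact_iff_compactSpace.1 (isClosed_smulInvariantMeasure G Y).isCompact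
    -- A continuous bijection from a compact space to a Hausdorff space.
    exact isHomeomorph_iff_continuous_bijective.2
      ⟨(σ.continuous_map_lift hπ ν.2 hmap).subtype_mk _, hbij⟩
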